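/- **Definitions.** Let $k\ge 3$ be an integer and write $e(x)=e^{2\pi i x}$. Put $$\theta_\infty(x)=\tfrac{i}{2\pi}\Bigl\{\bigl(x+\sqrt{x^2-1}\bigr)^{k-1}-\bigl(x-\sqrt{x^2-1}\bigr)^{k-1}\Bigr\}\ \ (|x|<1),\qquad \theta_\infty(x)=0\ \ (|x|\ge 1),$$ with $\sqrt{x^2-1}=i\sqrt{1-x^2}$ for $|x|<1$. Let $K_0$ be the modified Bessel function, so that $2K_0(2)=\int_0^\infty e^{-y-1/y}\tfrac{dy}{y}$, let $$F(x)=\frac{1}{2K_0(2)}\int_x^\infty e^{-y-1/y}\,\frac{dy}{y},\qquad \tilde F(u)=\int_0^\infty F(x)x^{u-1}\,dx,$$ $$H(y)=\frac{\sqrt\pi}{2\pi i}\int_{\Re u=1}\frac{\Gamma\left(\frac{1+u}{2}\right)}{\Gamma\left(\frac{2-u}{2}\right)}(\pi y)^{-u}\tilde F(u)\,du .$$ For integers $l,f\ge 1$, $\xi,n\in\mathbb Z$ let $$Kl_{l,f}(\xi,n)=\sum_{\substack{a \bmod 4lf^2\\ f^2\mid a^2-4n\\ (a^2-4n)/f^2\equiv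 0,1 \bmod 4}}\left(\frac{(a^2-4n)/f^2}{l}\right)e\!\left(\frac{a\xi}{4lf^2}\right),$$ where $(\frac{\cdot}{\cdot})$ is the Kronecker symbol, and for $n>0$ let $$I_{l,f}(\xi,n)=\int_{-1}^{1}\theta_\infty(x)\bigl\{F(t_x)+t_xH(t_x)\bigr\}\,e\!\left(\frac{-x\xi\sqrt n}{2lf^2}\right)dx,\qquad t_x=\frac{lf^2(4n)^{-1/2}}{\sqrt{1-x^2}} .$$ Fix constants $c_1,c_2,c_3,c_4>0$. For $\kappa,\alpha>0$, $X\ge 2$ and $G\in C_c^\infty([\frac14,\frac54])$, that is, a smooth (real- or complex-valued) function on $\mathbb R$ whose support is contained in $[\frac14,\frac54]$, let $$S_G(X,\kappa,\alpha)=\sum_{n\in\mathbb Z}G\!\left(\tfrac nX\right)\sqrt n\sum_{\substack{l,f\ge 1\\ c_1X^{\frac14-\kappa}\le lf^2\le c_2X^{\frac12+\kappa}}}\frac{1}{l^2f^3}\sum_{\substack{\xi\in\mathbb Z\setminus\{0\}\\ lf^2|\xi|\le c_3X^{\frac12+\kappa}\\ |\xi|\le c_4X^{\frac16+\kappa+\alpha}}}Kl_{l,f}(\xi,n)\,I_{l,f}(\xi,n)$$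 (only terms with $n>0$ contribute, since $G$ vanishes outside $[\frac14,\frac54]$). **Theorem.** Let $k\ge3$ and $M\ge 2$ be integers, let $c_1,c_2,c_3,c_4>0$, and let $\kappa,\alpha>0$ satisfy $2\kappa+\alpha<\frac1{12}$. There is a constant $C$, depending only on $k,\kappa,\alpha,M$ and $c_1,\dots,c_4$, such that for every $G\in C_c^\infty([\frac14,\frac54])$ and every real $X\ge 2$, $$\bigl|S_G(X,\kappa,\alpha)\bigr|\le C\,\|G\|_{M,1}\,X^{\frac{17}{12}+2\kappa+\alpha-M\left(\frac13-\kappa-\alpha\right)}\log X,\qquad \|G\|_{M,1}=\sum_{j=0}^M\int_{\mathbb R}|G^{(j)}(x)|\,dx .$$ -/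

import Mathlib

open MeasureTheory
open scoped ContDiff

namespace CriticalRange

noncomputable section

/-- The Kronecker symbol `(a / l)` for an integer `a` and an integer `l ≥ 1`: it is completely
multiplicative in `l`, with `(a / p)` the Legendre symbol at odd primes `p`, and
`(a / 2) = 0, 1, -1` according as `a` is even, `a ≡ ±1 mod 8`, `a ≡ ±3 mod 8`. -/
def kronecker (a : ℤ) (l : ℕ) : ℤ :=
  ZMod.χ₈ (a : ZMod 8) ^ l.factorization 2 * jacobiSym a (l / 2 ^ l.factorization 2)

/-- `e(x) = exp(2πix)`. -/
def e (x : ℝ) : ℂ := Complex.exp (2 * (Real.pi : ℂ) * Complex.I * (x : ℂ))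

open Classical in
/-- `Kl_{l,f}(ξ,n)`: the sum of `((a² - 4n)/f² / l) e(aξ / (4lf²))` over the residues `a mod 4lf²`
with `f² ∣ a² - 4n` and `(a² - 4n)/f² ≡ 0, 1 mod 4`. -/
def Kl (l f : ℕ) (ξ n : ℤ) : ℂ :=
  ∑ a ∈ (Finset.range (4 * l * f ^ 2)).filter (fun a : ℕ =>
      (f : ℤ) ^ 2 ∣ (a : ℤ) ^ 2 - 4 * n ∧
      (((a : ℤ) ^ 2 - 4 * n) / (f : ℤ) ^ 2 ≡ 0 [ZMOD 4] ∨
        ((a : ℤ) ^ 2 - 4 * n) / (f : ℤ) ^ 2 ≡ 1 [ZMOD 4])),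
    (kronecker (((a : ℤ) ^ 2 - 4 * n) / (f : ℤ) ^ 2) l : ℂ) *
      e ((a : ℝ) * (ξ : ℝ) / (4 * (l : ℝ) * (f : ℝ) ^ 2))

/-- `θ_∞(x) = (i/2π) {(x + √(x²-1))^{k-1} - (x - √(x²-1))^{k-1}}` for `|x| < 1`, and `0` otherwise;
for `|x| < 1` the principal value of `√(x²-1)` is `i √(1-x²)`. -/
def thetaInf (k : ℕ) (x : ℝ) : ℂ :=
  if |x| < 1 then
    Complex.I / (2 * (Real.pi : ℂ)) *
      (((x : ℂ) + Complex.I * (Real.sqrt (1 - x ^ 2) : ℂ)) ^ (k - 1) -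
        ((x : ℂ) - Complex.I * (Real.sqrt (1 - x ^ 2) : ℂ)) ^ (k - 1))
  else 0

/-- The modified Bessel function `K_0(z) = (1/2) ∫_0^∞ exp(-(z/2)(t + 1/t)) dt/t`, for `z > 0`. -/
def besselK0 (z : ℝ) : ℝ :=
  1 / 2 * ∫ t in Set.Ioi (0 : ℝ), Real.exp (-(z / 2) * (t + 1 / t)) / t

/-- `F(x) = (1 / (2 K_0(2))) ∫_x^∞ exp(-y - 1/y) dy/y`, used for `x ≥ 0`. -/
def F (x : ℝ) : ℝ :=
  1 / (2 * besselK0 2) * ∫ y in Set.Ioi x, Real.exp (-y - 1 / y) / y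

/-- `H(y) = (√π / 2πi) ∫_{(1)} Γ((1+u)/2) / Γ((2-u)/2) (πy)^{-u} F̃(u) du`, for `y > 0`, where
`F̃` is the Mellin transform of `F`; on the line `u = 1 + it` one has `du = i dt`. -/
def H (y : ℝ) : ℂ :=
  (Real.sqrt Real.pi : ℂ) *
    mellinInv 1
      (fun u : ℂ => Complex.Gamma ((1 + u) / 2) / Complex.Gamma ((2 - u) / 2) *
        mellin (fun x : ℝ => (F x : ℂ)) u)
      (Real.pi * y)

/-- `I_{l,f}(ξ,y)`, the integral over `-1 < x < 1` of
`θ_∞(x) {F(t) + t H(t)} e(-xξ√y / (2lf²))`, where `t = lf² (4y)^{-1/2} / √(1-x²)`; here `y > 0`. -/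
def I (k l f : ℕ) (ξ : ℤ) (y : ℝ) : ℂ :=
  ∫ x in (-1 : ℝ)..1,
    let t : ℝ := (l : ℝ) * (f : ℝ) ^ 2 / Real.sqrt (4 * y) / Real.sqrt (1 - x ^ 2)
    thetaInf k x * ((F t : ℂ) + (t : ℂ) * H t) *
      e (-(x * (ξ : ℝ) * Real.sqrt y) / (2 * (l : ℝ) * (f : ℝ) ^ 2))

/-- The triples `(l, f, ξ)` of the critical range, with the constants of the relations `≪`, `≫`
written out: `l, f ≥ 1`, `ξ ≠ 0`, `c₁ X^{1/4-κ} ≤ lf² ≤ c₂ X^{1/2+κ}`, `lf²|ξ| ≤ c₃ X^{1/2+κ}` and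
`|ξ| ≤ c₄ X^{1/6+κ+α}`. -/
def criticalRange (c₁ c₂ c₃ c₄ κ α X : ℝ) : Set (ℕ × ℕ × ℤ) :=
  {p | 1 ≤ p.1 ∧ 1 ≤ p.2.1 ∧ p.2.2 ≠ 0 ∧
    c₁ * X ^ (1 / 4 - κ) ≤ (p.1 : ℝ) * (p.2.1 : ℝ) ^ 2 ∧
    (p.1 : ℝ) * (p.2.1 : ℝ) ^ 2 ≤ c₂ * X ^ (1 / 2 + κ) ∧
    (p.1 : ℝ) * (p.2.1 : ℝ) ^ 2 * |(p.2.2 : ℝ)| ≤ c₃ * X ^ (1 / 2 + κ) ∧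
    |(p.2.2 : ℝ)| ≤ c₄ * X ^ (1 / 6 + κ + α)}

theorem criticalRange_finite (c₁ c₂ c₃ c₄ κ α X : ℝ) :
    (criticalRange c₁ c₂ c₃ c₄ κ α X).Finite := by
  set A := ⌊c₂ * X ^ (1 / 2 + κ)⌋₊
  set B := ⌊c₄ * X ^ (1 / 6 + κ + α)⌋
  refine ((Set.finite_Iic A).prod ((Set.finite_Iic A).prod (Set.finite_Icc (-B) B))).subset ?_
  rintro ⟨l, f, ξ⟩ ⟨hl, hf, -, -, h2, -, h4⟩
  simp only at hl hf h2 h4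
  have hl' : (1 : ℝ) ≤ l := by exact_mod_cast hl
  have hf' : (1 : ℝ) ≤ f := by exact_mod_cast hf
  have hB : |ξ| ≤ B := Int.le_floor.2 (by exact_mod_cast h4)
  refine ⟨?_, ?_, ?_⟩
  · refine Nat.le_floor (le_trans ?_ h2)
    show (l : ℝ) ≤ (l : ℝ) * (f : ℝ) ^ 2
    nlinarith [one_le_pow₀ hf' (n := 2)]
  · refine Nat.le_floor (le_trans ?_ h2)
    show (f : ℝ) ≤ (l : ℝ) * (f : ℝ) ^ 2
    nlinarith [mul_nonneg (sub_nonneg.2 hl') (sq_nonneg (f : ℝ))]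
  · exact abs_le.1 hB

/-- The smoothed sum over the critical range,
`S_G = ∑_n G(n/X) √n ∑_{(l,f,ξ)} (1 / (l²f³)) Kl_{l,f}(ξ,n) I_{l,f}(ξ,n)`.
The sum over `n` has finitely many nonzero terms when `G` has compact support and `X > 0`. -/
def SG (k : ℕ) (c₁ c₂ c₃ c₄ κ α : ℝ) (G : ℝ → ℂ) (X : ℝ) : ℂ :=
  ∑' n : ℤ, G ((n : ℝ) / X) * (Real.sqrt (n : ℝ) : ℂ) *
    ∑ p ∈ (criticalRange_finite c₁ c₂ c₃ c₄ κ α X).toFinset,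
      1 / ((p.1 : ℂ) ^ 2 * (p.2.1 : ℂ) ^ 3) *
        Kl p.1 p.2.1 p.2.2 n * I k p.1 p.2.1 p.2.2 (n : ℝ)

/-- The Sobolev norm `‖G‖_{M,1} = ∑_{j=0}^{M} ‖G^{(j)}‖_1`. -/
def sobolevNorm (M : ℕ) (G : ℝ → ℂ) : ℝ :=
  ∑ j ∈ Finset.range (M + 1), ∫ x : ℝ, ‖iteratedDeriv j G x‖

end

end CriticalRange

/-! Write q = lf². For fixed (l, f, ξ) the sum over n is a smooth sum against `Kl`, which is
periodic in n modulo q, so Poisson summation in residue classes applies. The zero frequency carries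
the mean of `Kl` over a period. The substitution a ↦ a + 2, n ↦ n + a + 1 preserves a² - 4n and
multiplies this mean by e(ξ/2q), so the mean vanishes if 0 < |ξ| < 2q (`sum_Kl_eq_zero`). Since 2κ +
α < 1/12, the critical range satisfies |ξ| < 2q once X is large, and bounded X is absorbed into the
constant (`exists_meanIndicator_le`).

For the other frequencies the weight must be smooth with uniform bounds. On Re u = 1 the Mellin
transform of F is the Fourier transform of a Schwartz function, and the Gamma quotient grows at most
linearly. Hence F(t) + tH(t) is a smooth function of log t with all derivatives bounded
(`exists_iteratedDeriv_weight_le`). With x = cos θ, `thetaInf` becomes a multiple of sin((k-1)θ),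
and one integration by parts in θ gains the factor q/(|ξ|√n), whose √n cancels the one in the sum
(`I_eq`). For fixed θ the remaining function of z = n/X is G(z) exp(iμ√z) V(c - ½ log z) with |μ| ≤
π|ξ|√X/q. Each derivative costs 1 + |μ| and each integration by parts in Poisson gains q/X, a net
factor of at most a constant times a = q/X + |ξ|/√X.

Trivially the sum over n is O(q · X), so a triple contributes O(X q²/|ξ| · a^M) (`exists_term_le`),
and the weight 1/(l²f³) turns q² into f. Of the M factors a, M - 2 are bounded by X^(-1/3+κ+α) and
two by |ξ| X^(-1/2+κ), up to constants (`saving_le`). There remains the sum of f|ξ| over the range,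
which the bound on lf²|ξ| controls with a logarithmic loss (`sum_range_triples_le`). -/

namespace CriticalRange

open Real Set Filter Topology FourierTransform

/-! ### Functions of rapid decay with derivatives of the same kind -/

/-- A function which decays faster than every power. -/
def RapidDecay (f : ℝ → ℂ) : Prop := ∀ k : ℕ, ∃ C, ∀ x : ℝ, |x| ^ k * ‖f x‖ ≤ C

theorem RapidDecay.add {f g : ℝ → ℂ} (hf : RapidDecay f) (hg : RapidDecay g) :
    RapidDecay (f + g) := fun k => by
  obtain ⟨C, hC⟩ := hf k
  obtain ⟨D, hD⟩ := hg k
  refine ⟨C + D, fun x => ?_⟩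
  calc |x| ^ k * ‖f x + g x‖ ≤ |x| ^ k * (‖f x‖ + ‖g x‖) := by gcongr; exact norm_add_le _ _
    _ ≤ C + D := by rw [mul_add]; exact add_le_add (hC x) (hD x)

theorem RapidDecay.smul {f : ℝ → ℂ} (c : ℂ) (hf : RapidDecay f) : RapidDecay (c • f) := fun k => by
  obtain ⟨C, hC⟩ := hf k
  refine ⟨‖c‖ * C, fun x => ?_⟩
  calc |x| ^ k * ‖c * f x‖ = ‖c‖ * (|x| ^ k * ‖f x‖) := by rw [norm_mul]; ring
    _ ≤ ‖c‖ * C := by gcongr; exact hC x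

theorem RapidDecay.of_exp_le {f : ℝ → ℂ} {C : ℝ} (h : ∀ x, ‖f x‖ ≤ C * exp (-|x|)) :
    RapidDecay f := fun k => by
  have hC : 0 ≤ C := by
    have := (norm_nonneg _).trans (h 0)
    simpa using this
  refine ⟨C * k.factorial, fun x => ?_⟩
  have h1 := Real.pow_div_factorial_le_exp |x| (abs_nonneg x) k
  rw [div_le_iff₀ (by positivity)] at h1
  calc |x| ^ k * ‖f x‖ ≤ (exp |x| * k.factorial) * (C * exp (-|x|)) := by gcongr; exact h x
    _ = C * k.factorial * (exp |x| * exp (-|x|)) := by ring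
    _ = C * k.factorial := by rw [← exp_add]; simp

/-- If a space of functions is stable under differentiation, then so it is under iterated
differentiation. -/
theorem iteratedDeriv_mem_of_deriv_mem {S : Submodule ℂ (ℝ → ℂ)}
    (hS : ∀ f ∈ S, Differentiable ℝ f ∧ deriv f ∈ S) {f : ℝ → ℂ} (hf : f ∈ S) (n : ℕ) :
    iteratedDeriv n f ∈ S := by
  induction n with
  | zero => simpa using hf
  | succ n ih => rw [iteratedDeriv_succ]; exact (hS _ ih).2

theorem contDiff_of_deriv_mem {S : Submodule ℂ (ℝ → ℂ)}
    (hS : ∀ f ∈ S, Differentiable ℝ f ∧ deriv f ∈ S) {f : ℝ → ℂ} (hf : f ∈ S) :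
    ContDiff ℝ ∞ f :=
  contDiff_of_differentiable_iteratedDeriv fun m _ =>
    (hS _ (iteratedDeriv_mem_of_deriv_mem hS hf m)).1

/-- Stability under differentiation need only be checked on generators, since differentiation is
linear. -/
theorem span_deriv_mem {s : Set (ℝ → ℂ)}
    (hs : ∀ f ∈ s, Differentiable ℝ f ∧ deriv f ∈ Submodule.span ℂ s) :
    ∀ f ∈ Submodule.span ℂ s, Differentiable ℝ f ∧ deriv f ∈ Submodule.span ℂ s := by
  intro f hf
  induction hf using Submodule.span_induction with
  | mem f hf => exact hs f hf
  | zero => exact ⟨differentiable_const 0, by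
      have : deriv (0 : ℝ → ℂ) = 0 := by ext x; exact deriv_const x 0
      rw [this]; exact Submodule.zero_mem _⟩
  | add f g _ _ hf hg => exact ⟨hf.1.add hg.1, by
      have : deriv (f + g) = deriv f + deriv g := by ext x; exact deriv_add (hf.1 x) (hg.1 x)
      rw [this]; exact Submodule.add_mem _ hf.2 hg.2⟩
  | smul c f _ hf => exact ⟨hf.1.const_smul c, by
      have : deriv (c • f) = c • deriv f := by ext x; exact deriv_const_smul c (hf.1 x)
      rw [this]; exact Submodule.smul_mem _ _ hf.2⟩

/-! ### The function `F` -/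

/-- `exp(av - e^v - e^{-v})`. -/
noncomputable def expKernel (a : ℤ) (v : ℝ) : ℂ := (exp (a * v - exp v - exp (-v)) : ℝ)

/-- Multiplication by exp(±v) shifts the index a by ±1, so the span of these functions is closed
under differentiation. -/
theorem hasDerivAt_expKernel (a : ℤ) (v : ℝ) :
    HasDerivAt (expKernel a)
      ((a : ℂ) * expKernel a v - expKernel (a + 1) v + expKernel (a - 1) v) v := by
  have h1 : HasDerivAt (fun v : ℝ => (a : ℝ) * v - exp v - exp (-v)) (a - exp v + exp (-v)) v := by
    convert! (((hasDerivAt_id v).const_mul (a : ℝ)).sub (hasDerivAt_exp v)).sub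
      (hasDerivAt_neg v).exp using 1
    ring
  have h2 := h1.exp.ofReal_comp
  convert! h2 using 1
  simp only [expKernel]
  have e1 : exp (((a + 1 : ℤ) : ℝ) * v - exp v - exp (-v)) =
      exp (a * v - exp v - exp (-v)) * exp v := by
    rw [← exp_add]; push_cast; ring_nf
  have e2 : exp (((a - 1 : ℤ) : ℝ) * v - exp v - exp (-v)) =
      exp (a * v - exp v - exp (-v)) * exp (-v) := by
    rw [← exp_add]; push_cast; ring_nf
  rw [e1, e2]
  push_cast
  ring

theorem exists_expKernel_le (a : ℤ) : ∃ C, ∀ v, ‖expKernel a v‖ ≤ C * exp (-|v|) := by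
  -- The constant comes from y^N / N! ≤ exp y with y = exp|v| and N = |a| + 1: |a| powers absorb
  -- exp(av), and the extra one leaves exp(-|v|).
  refine ⟨(a.natAbs + 1).factorial, fun v => ?_⟩
  rw [expKernel, Complex.norm_real, Real.norm_eq_abs, abs_of_pos (exp_pos _)]
  have h1 : a * v - exp v - exp (-v) ≤ a.natAbs * |v| - exp |v| := by
    have h3 : (a : ℝ) * v ≤ a.natAbs * |v| := by
      rw [Nat.cast_natAbs, Int.cast_abs, ← abs_mul]; exact le_abs_self _
    rcases abs_cases v with h | h <;> rw [h.1] at h3 ⊢ <;>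
      linarith [exp_pos v, exp_pos (-v)]
  have h2 := Real.pow_div_factorial_le_exp (exp |v|) (exp_pos _).le (a.natAbs + 1)
  rw [div_le_iff₀ (by positivity), ← exp_nat_mul] at h2
  calc exp (a * v - exp v - exp (-v)) ≤ exp (a.natAbs * |v| - exp |v|) := exp_le_exp.2 h1
    _ = exp (((a.natAbs + 1 : ℕ) : ℝ) * |v|) * (exp (-exp |v|) * exp (-|v|)) := by
        rw [← exp_add, ← exp_add]; push_cast; ring_nf
    _ ≤ (exp (exp |v|) * (a.natAbs + 1).factorial) * (exp (-exp |v|) * exp (-|v|)) := by gcongr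
    _ = (a.natAbs + 1).factorial * exp (-|v|) * (exp (exp |v|) * exp (-exp |v|)) := by ring
    _ = _ := by rw [← exp_add]; simp

theorem kernel_le_exp {y : ℝ} (hy : 0 < y) : exp (-y - 1 / y) / y ≤ exp (-y) := by
  rw [div_le_iff₀ hy, sub_eq_add_neg, exp_add]
  gcongr
  rw [exp_neg, inv_le_comm₀ (exp_pos _) hy, ← one_div]
  linarith [add_one_le_exp (1 / y)]

theorem continuousOn_kernel : ContinuousOn (fun y : ℝ => exp (-y - 1 / y) / y) (Ioi 0) := by
  have : ∀ y ∈ Ioi (0 : ℝ), y ≠ 0 := fun y hy => ne_of_gt hy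
  fun_prop (disch := assumption)

theorem integrableOn_kernel {x : ℝ} (hx : 0 ≤ x) :
    IntegrableOn (fun y : ℝ => exp (-y - 1 / y) / y) (Ioi x) := by
  refine Integrable.mono' (integrableOn_exp_neg_Ioi x)
    ((continuousOn_kernel.mono (Ioi_subset_Ioi hx)).aestronglyMeasurable measurableSet_Ioi) ?_
  refine (ae_restrict_iff' measurableSet_Ioi).2 (.of_forall fun y hy => ?_)
  have hy' : 0 < y := hx.trans_lt hy
  rw [Real.norm_eq_abs, abs_of_nonneg (by positivity)]
  exact kernel_le_exp hy'

/-- The normalising constant of `F`. -/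
noncomputable def normF : ℝ := 1 / (2 * besselK0 2)

theorem besselK0_nonneg (z : ℝ) : 0 ≤ besselK0 z := by
  refine mul_nonneg (by norm_num) (setIntegral_nonneg measurableSet_Ioi fun t ht => ?_)
  exact div_nonneg (exp_pos _).le (le_of_lt ht)

theorem normF_nonneg : 0 ≤ normF := by
  have := besselK0_nonneg 2
  unfold normF
  positivity

theorem F_nonneg {x : ℝ} (hx : 0 ≤ x) : 0 ≤ F x := by
  refine mul_nonneg normF_nonneg (setIntegral_nonneg measurableSet_Ioi fun t ht => ?_)
  exact div_nonneg (exp_pos _).le (hx.trans (le_of_lt ht))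

theorem F_le {x : ℝ} (hx : 0 ≤ x) : F x ≤ normF * exp (-x) := by
  rw [← integral_exp_neg_Ioi]
  refine mul_le_mul_of_nonneg_left ?_ normF_nonneg
  exact setIntegral_mono_on (integrableOn_kernel hx) (integrableOn_exp_neg_Ioi x) measurableSet_Ioi
    fun y hy => kernel_le_exp (hx.trans_lt hy)

theorem hasDerivAt_F {x : ℝ} (hx : 0 < x) :
    HasDerivAt F (-(normF * (exp (-x - 1 / x) / x))) x := by
  have hx2 : 0 < x / 2 := by positivity
  -- The base point x/2 keeps the interval of integration inside (0, ∞), where the integrand is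
  -- continuous, so the fundamental theorem of calculus applies.
  have key : ∀ᶠ z in 𝓝 x, F z = normF * ((∫ y in Ioi (x / 2), exp (-y - 1 / y) / y) -
      ∫ y in (x / 2)..z, exp (-y - 1 / y) / y) := by
    filter_upwards [lt_mem_nhds (show x / 2 < x by linarith)] with z hz
    have hz0 : 0 ≤ z := (hx2.trans hz).le
    rw [F, ← normF, ← intervalIntegral.integral_interval_add_Ioi (integrableOn_kernel hx2.le)
      (integrableOn_kernel hz0), add_sub_cancel_left]
  have hc : ContinuousOn (fun y : ℝ => exp (-y - 1 / y) / y) (Ioi 0) := continuousOn_kernel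
  have h1 : HasDerivAt (fun z => ∫ y in (x / 2)..z, exp (-y - 1 / y) / y)
      (exp (-x - 1 / x) / x) x := by
    refine intervalIntegral.integral_hasDerivAt_right ?_ ?_ (hc.continuousAt (Ioi_mem_nhds hx))
    · refine (hc.mono ?_).intervalIntegrable
      rw [uIcc_of_le (by linarith)]
      exact fun y hy => hx2.trans_le hy.1
    · exact hc.stronglyMeasurableAtFilter isOpen_Ioi x hx
  refine HasDerivAt.congr_of_eventuallyEq ?_ key
  convert! (h1.const_sub (∫ y in Ioi (x / 2), exp (-y - 1 / y) / y)).const_mul normF using 1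
  ring

theorem hasDerivAt_F_exp (v : ℝ) :
    HasDerivAt (fun v => (F (exp v) : ℂ)) (-(normF : ℂ) * expKernel 0 v) v := by
  have h := ((hasDerivAt_F (exp_pos v)).comp v (hasDerivAt_exp v)).ofReal_comp
  convert! h using 1
  rw [expKernel, ← Complex.ofReal_neg, ← Complex.ofReal_mul]
  congr 1
  have := (exp_pos v).ne'
  rw [neg_mul, neg_mul, mul_assoc, div_mul_cancel₀ _ this, one_div, ← exp_neg]
  simp [sub_eq_add_neg]

/-- The function whose Fourier transform is the Mellin transform of `F` on `Re u = 1`. -/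
noncomputable def mellinKernel (u : ℝ) : ℂ := (exp (-u) : ℂ) * (F (exp (-u)) : ℂ)

theorem hasDerivAt_mellinKernel (u : ℝ) :
    HasDerivAt mellinKernel (-mellinKernel u + normF * expKernel (-1) u) u := by
  have h1 := (hasDerivAt_F_exp (-u)).scomp u (hasDerivAt_neg u)
  have h2 : HasDerivAt (fun u : ℝ => ((exp (-u) : ℝ) : ℂ)) ((-exp (-u) : ℝ) : ℂ) u := by
    have := (hasDerivAt_neg u).exp.ofReal_comp
    simpa using this
  have h3 : HasDerivAt mellinKernel _ u := h2.mul h1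
  convert! h3 using 1
  · have e1 : expKernel (-1) u = ((exp (-u) : ℝ) : ℂ) * expKernel 0 (-u) := by
      simp only [expKernel]
      rw [← Complex.ofReal_mul, ← exp_add]
      push_cast
      ring_nf
    rw [e1]
    simp [mellinKernel]
    ring

theorem exists_mellinKernel_le : ∃ C, ∀ u, ‖mellinKernel u‖ ≤ C * exp (-|u|) := by
  refine ⟨normF * 2, fun u => ?_⟩
  have h0 : 0 ≤ F (exp (-u)) := F_nonneg (exp_pos _).le
  rw [mellinKernel, norm_mul, Complex.norm_real,
    Complex.norm_real, Real.norm_of_nonneg (exp_pos _).le, Real.norm_of_nonneg h0]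
  have h1 := F_le (exp_pos (-u)).le
  have h2 : exp (-u) * exp (-exp (-u)) ≤ 2 * exp (-|u|) := by
    rcases abs_cases u with h | h <;> rw [h.1]
    · have : exp (-exp (-u)) ≤ 1 := exp_le_one_iff.2 (by linarith [exp_pos (-u)])
      nlinarith [exp_pos (-u)]
    -- For u < 0 the decay comes from y²/2 ≤ exp y with y = exp(-u), which also explains the factor
    -- 2 in the constant.
    · have h2 := Real.pow_div_factorial_le_exp (exp (-u)) (exp_pos _).le 2
      rw [div_le_iff₀ (by positivity)] at h2
      simp only [neg_neg]
      have e : exp (-u) = exp (-u) ^ 2 * exp u := by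
        rw [pow_two, ← exp_add, ← exp_add]; ring_nf
      calc exp (-u) * exp (-exp (-u)) = exp (-u) ^ 2 * (exp u * exp (-exp (-u))) := by
            rw [← mul_assoc, ← e]
        _ ≤ exp (exp (-u)) * Nat.factorial 2 * (exp u * exp (-exp (-u))) := by gcongr
        _ = 2 * exp u * (exp (exp (-u)) * exp (-exp (-u))) := by simp; ring
        _ = 2 * exp u := by rw [← exp_add]; simp
  calc exp (-u) * F (exp (-u)) ≤ exp (-u) * (normF * exp (-exp (-u))) := by gcongr
    _ = normF * (exp (-u) * exp (-exp (-u))) := by ring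
    _ ≤ normF * (2 * exp (-|u|)) := by gcongr; exact normF_nonneg
    _ = _ := by ring

/-- The space spanned by `mellinKernel` and its derivatives. -/
noncomputable def kernelSpace : Submodule ℂ (ℝ → ℂ) :=
  Submodule.span ℂ (insert mellinKernel (range expKernel))

theorem expKernel_mem (a : ℤ) : expKernel a ∈ kernelSpace :=
  Submodule.subset_span (mem_insert_of_mem _ (mem_range_self a))

theorem mellinKernel_mem : mellinKernel ∈ kernelSpace :=
  Submodule.subset_span (mem_insert _ _)

theorem kernelSpace_deriv : ∀ f ∈ kernelSpace, Differentiable ℝ f ∧ deriv f ∈ kernelSpace := by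
  refine span_deriv_mem ?_
  rintro f (rfl | ⟨a, rfl⟩)
  · refine ⟨fun u => (hasDerivAt_mellinKernel u).differentiableAt, ?_⟩
    have : deriv mellinKernel = -mellinKernel + (normF : ℂ) • expKernel (-1) := by
      ext u; exact (hasDerivAt_mellinKernel u).deriv
    rw [this]
    exact kernelSpace.add_mem (kernelSpace.neg_mem mellinKernel_mem)
      (kernelSpace.smul_mem _ (expKernel_mem _))
  · refine ⟨fun u => (hasDerivAt_expKernel a u).differentiableAt, ?_⟩
    have : deriv (expKernel a) = (a : ℂ) • expKernel a - expKernel (a + 1) + expKernel (a - 1) := by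
      ext u; exact (hasDerivAt_expKernel a u).deriv
    rw [this]
    exact kernelSpace.add_mem (kernelSpace.sub_mem (kernelSpace.smul_mem _ (expKernel_mem _))
      (expKernel_mem _)) (expKernel_mem _)

theorem kernelSpace_rapidDecay {f : ℝ → ℂ} (hf : f ∈ kernelSpace) : RapidDecay f := by
  induction hf using Submodule.span_induction with
  | mem f hf =>
    rcases hf with rfl | ⟨a, rfl⟩
    · exact RapidDecay.of_exp_le exists_mellinKernel_le.choose_spec
    · exact RapidDecay.of_exp_le (exists_expKernel_le a).choose_spec
  | zero => exact fun k => ⟨0, fun x => by simp⟩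
  | add f g _ _ hf hg => exact hf.add hg
  | smul c f _ hf => exact hf.smul c

open SchwartzMap in
/-- `mellinKernel` as a Schwartz function. -/
noncomputable def mellinSchwartz : 𝓢(ℝ, ℂ) where
  toFun := mellinKernel
  smooth' := contDiff_of_deriv_mem kernelSpace_deriv mellinKernel_mem
  decay' k n := by
    obtain ⟨C, hC⟩ := kernelSpace_rapidDecay
      (iteratedDeriv_mem_of_deriv_mem kernelSpace_deriv mellinKernel_mem n) k
    refine ⟨C, fun x => ?_⟩
    rw [norm_iteratedFDeriv_eq_norm_iteratedDeriv]
    exact hC x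

/-- The substitution x = exp(-u) turns the Mellin integral into a Fourier integral; the factor
exp(-u) in `mellinKernel` comes from Re u = 1. -/
theorem mellin_F_eq (t : ℝ) :
    mellin (fun x : ℝ => (F x : ℂ)) (1 + t * Complex.I) = 𝓕 mellinSchwartz (t / (2 * π)) := by
  rw [mellin_eq_fourier, SchwartzMap.fourier_coe]
  have h : (fun u : ℝ => exp (-(1 + t * Complex.I : ℂ).re * u) • (F (exp (-u)) : ℂ)) =
      mellinSchwartz := by
    ext u
    change _ = mellinKernel u
    simp [mellinKernel]
  rw [h]
  simp

/-! ### The Gamma quotient -/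

/-- The quotient `Γ((1+u)/2) / Γ((2-u)/2)` on the line `u = 1 + it`. -/
noncomputable def gammaQuot (t : ℝ) : ℂ :=
  Complex.Gamma ((1 + (1 + t * Complex.I)) / 2) / Complex.Gamma ((2 - (1 + t * Complex.I)) / 2)

theorem continuous_gammaQuot : Continuous gammaQuot := by
  have h1 : Continuous fun t : ℝ => Complex.Gamma ((1 + (1 + t * Complex.I)) / 2) := by
    refine continuous_iff_continuousAt.2 fun t => ?_
    have h : ContinuousAt Complex.Gamma ((1 + (1 + t * Complex.I)) / 2) := by
      refine (Complex.differentiableAt_Gamma _ fun m hm => ?_).continuousAt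
      have := congrArg Complex.re hm
      simp at this
      have : (0 : ℝ) ≤ m := m.cast_nonneg
      linarith
    exact h.comp (f := fun t : ℝ => ((1 + (1 + t * Complex.I)) / 2 : ℂ)) (by fun_prop)
  have h2 : Continuous fun t : ℝ => (Complex.Gamma ((2 - (1 + t * Complex.I)) / 2))⁻¹ :=
    Complex.differentiable_one_div_Gamma.continuous.comp (by fun_prop)
  exact h1.mul h2

/-- Put s = 1 + it/2 and w = s - 1/2. The denominator is Γ at the conjugate of w, so it has modulus
|Γ(w)|. The Beta identity Γ(s)Γ(1/2) = Γ(s + 1/2)B(s, 1/2) together with Γ(s + 1/2) = wΓ(w) bounds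
the quotient by |w||B(s, 1/2)|, and the Beta integral is bounded uniformly in t because |x^(s-1)| =
1. Any polynomial bound would suffice, so Stirling's formula is not needed. -/
theorem exists_gammaQuot_le : ∃ C, ∀ t, ‖gammaQuot t‖ ≤ C * (1 + |t|) := by
  set B : ℝ := ∫ x in (0 : ℝ)..1, ‖((1 : ℂ) - (x : ℂ)) ^ ((1 / 2 : ℂ) - 1)‖
  refine ⟨B, fun t => ?_⟩
  set s : ℂ := 1 + t / 2 * Complex.I with hs
  have hsre : 0 < s.re := by simp [hs]
  have hhalf : (0 : ℝ) < (1 / 2 : ℂ).re := by norm_num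
  have hbeta : ‖Complex.betaIntegral s (1 / 2)‖ ≤ B := by
    refine (intervalIntegral.norm_integral_le_integral_norm zero_le_one).trans (le_of_eq ?_)
    refine intervalIntegral.integral_congr_ae (.of_forall fun x hx => ?_)
    rw [uIoc_of_le zero_le_one] at hx
    have : ‖(x : ℂ) ^ (s - 1)‖ = 1 := by
      rw [Complex.norm_cpow_eq_rpow_re_of_pos hx.1]
      simp [hs]
    rw [norm_mul, this, one_mul]
  have h1 := Complex.Gamma_mul_Gamma_eq_betaIntegral hsre hhalf
  set w : ℂ := s - 1 / 2 with hw
  have hwre : 0 < w.re := by simp [hw, hs]; norm_num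
  have hw0 : w ≠ 0 := fun h => by simp [h] at hwre
  have h2 : Complex.Gamma (s + 1 / 2) = w * Complex.Gamma w := by
    rw [← Complex.Gamma_add_one w hw0, hw]
    congr 1
    ring
  have hG : ‖Complex.Gamma ((2 - (1 + t * Complex.I)) / 2)‖ = ‖Complex.Gamma w‖ := by
    have : ((2 - (1 + t * Complex.I)) / 2 : ℂ) = (starRingEnd ℂ) w := by
      have : (starRingEnd ℂ) (t / 2 : ℂ) = t / 2 := by
        rw [← Complex.ofReal_ofNat, ← Complex.ofReal_div, Complex.conj_ofReal]
      rw [hw, hs]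
      simp only [map_sub, map_add, map_mul, map_one, this, Complex.conj_I, map_div₀, map_ofNat]
      ring
    rw [this, Complex.Gamma_conj, RCLike.norm_conj]
  have hs' : ((1 + (1 + t * Complex.I)) / 2 : ℂ) = s := by rw [hs]; ring
  have hGw : 0 < ‖Complex.Gamma w‖ := norm_pos_iff.2 (Complex.Gamma_ne_zero_of_re_pos hwre)
  have hwn : ‖w‖ ≤ 1 + |t| := by
    have : w = ((1 / 2 : ℝ) : ℂ) + ((t / 2 : ℝ) : ℂ) * Complex.I := by
      rw [hw, hs]; push_cast; ring
    rw [this]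
    refine (norm_add_le _ _).trans ?_
    rw [norm_mul, Complex.norm_I, Complex.norm_real, Complex.norm_real, mul_one, Real.norm_eq_abs,
      Real.norm_eq_abs, abs_div, abs_div, abs_one, abs_two]
    linarith [abs_nonneg t]
  have hpi : 1 ≤ ‖Complex.Gamma (1 / 2)‖ := by
    have : Complex.Gamma (1 / 2) = ((sqrt π : ℝ) : ℂ) := by
      rw [← Real.Gamma_one_half_eq, ← Complex.Gamma_ofReal]
      norm_num
    rw [this, Complex.norm_real, Real.norm_of_nonneg (sqrt_nonneg _), Real.one_le_sqrt]
    linarith [pi_gt_three]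
  rw [gammaQuot, hs', norm_div, hG, div_le_iff₀ hGw]
  calc ‖Complex.Gamma s‖ ≤ ‖Complex.Gamma s‖ * ‖Complex.Gamma (1 / 2)‖ :=
        le_mul_of_one_le_right (norm_nonneg _) hpi
    _ = ‖w‖ * ‖Complex.Gamma w‖ * ‖Complex.betaIntegral s (1 / 2)‖ := by
        rw [← norm_mul, h1, h2, norm_mul, norm_mul]
    _ ≤ (1 + |t|) * ‖Complex.Gamma w‖ * B := by gcongr
    _ = _ := by ring

/-- The Fourier side of `H`. -/
noncomputable def hKernel (t : ℝ) : ℂ := gammaQuot t * 𝓕 mellinSchwartz (t / (2 * π))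

theorem continuous_hKernel : Continuous hKernel :=
  continuous_gammaQuot.mul ((𝓕 mellinSchwartz).continuous.comp (by fun_prop))

/-- Linear growth of the Gamma quotient is harmless against Schwartz decay. Finite moments of every
order make the Fourier transform smooth with bounded derivatives. -/
theorem integrable_pow_mul_hKernel (n : ℕ) : Integrable fun t : ℝ => t ^ n • hKernel t := by
  obtain ⟨C, hC⟩ := exists_gammaQuot_le
  have hS : ∀ n : ℕ, Integrable fun t : ℝ => |t| ^ n * ‖𝓕 mellinSchwartz (t / (2 * π))‖ := by
    intro n
    have h := ((𝓕 mellinSchwartz).integrable_pow_mul volume n).comp_div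
      (show (2 * π) ≠ 0 by positivity)
    refine (h.const_mul ((2 * π) ^ n)).congr (.of_forall fun t => ?_)
    simp only [norm_div, Real.norm_eq_abs]
    rw [abs_of_pos (show 0 < 2 * π by positivity), div_pow]
    field_simp
  have hg : Integrable fun t : ℝ => C * (|t| ^ n * ‖𝓕 mellinSchwartz (t / (2 * π))‖ +
      |t| ^ (n + 1) * ‖𝓕 mellinSchwartz (t / (2 * π))‖) := ((hS n).add (hS (n + 1))).const_mul C
  refine hg.mono' ((by fun_prop : Continuous fun t : ℝ => t ^ n).smul
    continuous_hKernel).aestronglyMeasurable (.of_forall fun t => ?_)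
  rw [norm_smul, norm_pow, Real.norm_eq_abs, hKernel, norm_mul]
  calc |t| ^ n * (‖gammaQuot t‖ * ‖𝓕 mellinSchwartz (t / (2 * π))‖) ≤
      |t| ^ n * ((C * (1 + |t|)) * ‖𝓕 mellinSchwartz (t / (2 * π))‖) := by gcongr; exact hC t
    _ = _ := by ring

/-- On the line, (π exp v)^(-1-it) equals (π exp v)⁻¹ exp(-it(v + log π)). The prefactor exp v
cancels, leaving a Fourier integral with constant √π · 1/(2π) · 1/π. -/
theorem exp_mul_H (v : ℝ) :
    (exp v : ℂ) * H (exp v) =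
      ((sqrt π / (2 * π ^ 2) : ℝ) : ℂ) * 𝓕 hKernel ((v + log π) / (2 * π)) := by
  have hv := exp_pos v
  have hπv : π * exp v ≠ 0 := by positivity
  rw [H, mellinInv, Real.fourier_eq', Complex.real_smul, ← integral_const_mul,
    ← integral_const_mul, ← integral_const_mul, ← integral_const_mul]
  congr 1
  ext t
  have h1 : ((π * exp v : ℝ) : ℂ) ^ (-((1 : ℝ) + t * Complex.I) : ℂ) =
      (((π * exp v)⁻¹ : ℝ) : ℂ) *
        Complex.exp (((-2 * π * inner ℝ t ((v + log π) / (2 * π)) : ℝ) : ℂ) * Complex.I) := by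
    rw [Complex.cpow_def_of_ne_zero (by exact_mod_cast hπv), ← Complex.ofReal_log (by positivity),
      log_mul pi_ne_zero hv.ne', log_exp]
    have : (((π * exp v)⁻¹ : ℝ) : ℂ) = Complex.exp ((-(log π + v) : ℝ) : ℂ) := by
      rw [← Complex.ofReal_exp, exp_neg, exp_add, exp_log pi_pos]
    rw [this, ← Complex.exp_add]
    congr 1
    have hi : inner ℝ t ((v + log π) / (2 * π)) = (v + log π) / (2 * π) * t := rfl
    rw [hi]
    have : -2 * π * ((v + log π) / (2 * π) * t) = -(v + log π) * t := by
      field_simp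
    rw [this]
    push_cast
    ring
  have h2 := mellin_F_eq t
  rw [h1]
  simp only [smul_eq_mul, Complex.ofReal_one, hKernel, gammaQuot, h2]
  push_cast
  have : (π : ℂ) ≠ 0 := by exact_mod_cast pi_ne_zero
  have := Complex.exp_ne_zero v
  field_simp

/-- The weight `F(t) + t H(t)` in the variable `v = log t`. -/
noncomputable def weight (v : ℝ) : ℂ := (F (exp v) : ℂ) + (exp v : ℂ) * H (exp v)

theorem contDiff_fourier_hKernel : ContDiff ℝ ∞ (𝓕 hKernel) := by
  refine Real.contDiff_fourier fun n _ => ?_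
  have := (integrable_pow_mul_hKernel n).norm
  simpa only [norm_smul, norm_pow] using this

theorem contDiff_F_exp : ContDiff ℝ ∞ fun v : ℝ => (F (exp v) : ℂ) := by
  refine contDiff_infty_iff_deriv.2 ⟨fun v => (hasDerivAt_F_exp v).differentiableAt, ?_⟩
  have : deriv (fun v : ℝ => (F (exp v) : ℂ)) = (-(normF : ℂ)) • expKernel 0 := by
    ext v; exact (hasDerivAt_F_exp v).deriv
  rw [this]
  exact contDiff_of_deriv_mem kernelSpace_deriv (kernelSpace.smul_mem _ (expKernel_mem 0))

theorem weight_eq : weight = fun v => (F (exp v) : ℂ) +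
    ((sqrt π / (2 * π ^ 2) : ℝ) : ℂ) * 𝓕 hKernel ((2 * π)⁻¹ * (log π + v)) := by
  ext v
  rw [weight, exp_mul_H, div_eq_inv_mul (v + _), add_comm v]

theorem contDiff_hPart : ContDiff ℝ ∞ fun v : ℝ =>
    ((sqrt π / (2 * π ^ 2) : ℝ) : ℂ) * 𝓕 hKernel ((2 * π)⁻¹ * (log π + v)) :=
  contDiff_const.mul (contDiff_fourier_hKernel.comp (by fun_prop))

theorem contDiff_weight : ContDiff ℝ ∞ weight := by
  rw [weight_eq]
  exact contDiff_F_exp.add contDiff_hPart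

theorem exists_iteratedDeriv_F_exp_le (n : ℕ) :
    ∃ C, ∀ v, ‖iteratedDeriv n (fun v : ℝ => (F (exp v) : ℂ)) v‖ ≤ C := by
  cases n with
  | zero =>
    refine ⟨normF, fun v => ?_⟩
    rw [iteratedDeriv_zero, Complex.norm_real, Real.norm_of_nonneg (F_nonneg (exp_pos v).le)]
    refine (F_le (exp_pos v).le).trans (mul_le_of_le_one_right normF_nonneg ?_)
    exact exp_le_one_iff.2 (by linarith [exp_pos v])
  | succ n =>
    have : deriv (fun v : ℝ => (F (exp v) : ℂ)) = (-(normF : ℂ)) • expKernel 0 := by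
      ext v; exact (hasDerivAt_F_exp v).deriv
    rw [iteratedDeriv_succ', this]
    obtain ⟨C, hC⟩ := kernelSpace_rapidDecay (iteratedDeriv_mem_of_deriv_mem kernelSpace_deriv
      (kernelSpace.smul_mem (-(normF : ℂ)) (expKernel_mem 0)) n) 0
    exact ⟨C, fun v => by simpa using hC v⟩

theorem exists_iteratedDeriv_fourier_hKernel_le (n : ℕ) :
    ∃ C, ∀ v, ‖iteratedDeriv n (𝓕 hKernel) v‖ ≤ C := by
  rw [Real.iteratedDeriv_fourier (N := ⊤) (fun n _ => integrable_pow_mul_hKernel n) le_top]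
  refine ⟨∫ x, ‖(-2 * ↑π * Complex.I * ↑x) ^ n • hKernel x‖, fun v => ?_⟩
  rw [Real.fourier_eq]
  refine (norm_integral_le_integral_norm _).trans (le_of_eq ?_)
  simp only [Circle.norm_smul]

/-- The bounds hold on the whole line of v = log t. This uniformity matters because t tends to
infinity at the endpoints x = ±1, and no localisation in x is made. -/
theorem exists_iteratedDeriv_weight_le (n : ℕ) : ∃ C, ∀ v, ‖iteratedDeriv n weight v‖ ≤ C := by
  obtain ⟨C, hC⟩ := exists_iteratedDeriv_F_exp_le n
  obtain ⟨D, hD⟩ := exists_iteratedDeriv_fourier_hKernel_le n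
  refine ⟨C + ‖((sqrt π / (2 * π ^ 2) : ℝ) : ℂ)‖ * (‖(2 * π)⁻¹ ^ n‖ * D), fun v => ?_⟩
  have hn : (n : WithTop ℕ∞) ≤ ∞ := mod_cast le_top
  rw [weight_eq, iteratedDeriv_fun_add (contDiff_F_exp.of_le hn).contDiffAt
    (contDiff_hPart.of_le hn).contDiffAt, iteratedDeriv_const_mul_field]
  refine (norm_add_le _ _).trans (add_le_add (hC v) ?_)
  rw [norm_mul]
  gcongr
  have h1 := iteratedDeriv_comp_const_add n (fun x => 𝓕 hKernel ((2 * π)⁻¹ * x)) (log π)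
  have h2 := iteratedDeriv_comp_const_smul (contDiff_fourier_hKernel.of_le hn) (2 * π)⁻¹
  rw [h1, h2]
  simp only [norm_smul]
  gcongr
  exact hD _

/-! ### Integration by parts in `I` -/

/-- This offsets the pole 1/sin θ that arises from differentiating log(sin θ) inside the weight. -/
theorem abs_sin_nat_mul_le (n : ℕ) (x : ℝ) : |sin (n * x)| ≤ n * |sin x| := by
  induction n with
  | zero => simp
  | succ n ih =>
    push_cast
    rw [add_mul, one_mul, sin_add]
    calc |sin (n * x) * cos x + cos (n * x) * sin x| ≤
        |sin (n * x) * cos x| + |cos (n * x) * sin x| := abs_add_le _ _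
      _ ≤ |sin (n * x)| * 1 + 1 * |sin x| := by
        rw [abs_mul, abs_mul]
        gcongr
        · exact abs_cos_le_one x
        · exact abs_cos_le_one _
      _ ≤ (n + 1) * |sin x| := by linarith

/-- The bounded factor of the term with `V` after integration by parts. -/
noncomputable def coeffA (m : ℕ) (θ : ℝ) : ℝ := m * cos (m * θ)

/-- The bounded factor of the term with `V'` after integration by parts. -/
noncomputable def coeffB (m : ℕ) (θ : ℝ) : ℝ := -(sin (m * θ) * (cos θ / sin θ))

theorem abs_coeffA_le (m : ℕ) (θ : ℝ) : |coeffA m θ| ≤ m := by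
  rw [coeffA, abs_mul, Nat.abs_cast]
  exact mul_le_of_le_one_right (Nat.cast_nonneg m) (abs_cos_le_one _)

theorem abs_coeffB_le (m : ℕ) (θ : ℝ) : |coeffB m θ| ≤ m := by
  rw [coeffB, abs_neg, abs_mul, abs_div]
  rcases eq_or_ne (sin θ) 0 with h | h
  · simp [h]
  have h' := abs_pos.2 h
  rw [← mul_div_assoc, div_le_iff₀ h']
  calc |sin (m * θ)| * |cos θ| ≤ |sin (m * θ)| * 1 := by gcongr; exact abs_cos_le_one θ
    _ ≤ m * |sin θ| := by rw [mul_one]; exact abs_sin_nat_mul_le m θ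

/-- The oscillating factor `exp(-2πiμ cos θ)`. -/
noncomputable def osc (μ θ : ℝ) : ℂ := Complex.exp ((-(2 * π * μ * cos θ) : ℝ) * Complex.I)

theorem norm_osc (μ θ : ℝ) : ‖osc μ θ‖ = 1 := Complex.norm_exp_ofReal_mul_I _

theorem hasDerivAt_osc (μ θ : ℝ) :
    HasDerivAt (osc μ) (2 * π * μ * Complex.I * sin θ * osc μ θ) θ := by
  have h1 : HasDerivAt (fun θ : ℝ => -(2 * π * μ * cos θ)) (2 * π * μ * sin θ) θ := by
    convert! ((hasDerivAt_cos θ).const_mul (2 * π * μ)).neg using 1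
    ring
  convert! ((h1.ofReal_comp).mul_const Complex.I).cexp using 1
  simp only [osc]
  push_cast
  ring

theorem continuous_osc (μ : ℝ) : Continuous (osc μ) :=
  continuous_iff_continuousAt.2 fun θ => (hasDerivAt_osc μ θ).continuousAt

section

variable {V V' : ℝ → ℂ} {C : ℝ}

theorem continuousOn_sub_log_sin (c : ℝ) :
    ContinuousOn (fun θ => c - log (sin θ)) (Ioo 0 π) :=
  continuousOn_const.sub (continuous_sin.continuousOn.log fun _ hθ =>
    (sin_pos_of_mem_Ioo hθ).ne')

theorem continuousOn_byParts (hV : Continuous V) (hV' : Continuous V') (m : ℕ) (c μ : ℝ) :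
    ContinuousOn (fun θ => osc μ θ * (coeffA m θ * V (c - log (sin θ)) +
      coeffB m θ * V' (c - log (sin θ)))) (Ioo 0 π) := by
  have h1 := continuousOn_sub_log_sin c
  have hA : ContinuousOn (fun θ => (coeffA m θ : ℂ)) (Ioo 0 π) := by
    unfold coeffA
    exact Continuous.continuousOn (by fun_prop)
  have hB : ContinuousOn (fun θ => (coeffB m θ : ℂ)) (Ioo 0 π) := by
    refine Complex.continuous_ofReal.comp_continuousOn ?_
    refine ContinuousOn.neg (ContinuousOn.mul (by fun_prop) ?_)
    exact continuous_cos.continuousOn.div continuous_sin.continuousOn fun _ hθ =>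
      (sin_pos_of_mem_Ioo hθ).ne'
  exact (continuous_osc μ).continuousOn.mul ((hA.mul (hV.comp_continuousOn h1)).add
    (hB.mul (hV'.comp_continuousOn h1)))

theorem norm_byParts_le (hVC : ∀ v, ‖V v‖ ≤ C) (hVC' : ∀ v, ‖V' v‖ ≤ C) (m : ℕ) (c μ θ : ℝ) :
    ‖osc μ θ * (coeffA m θ * V (c - log (sin θ)) + coeffB m θ * V' (c - log (sin θ)))‖ ≤
      m * C + m * C := by
  rw [norm_mul, norm_osc, one_mul]
  refine (norm_add_le _ _).trans ?_
  rw [norm_mul, norm_mul, Complex.norm_real, Complex.norm_real]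
  gcongr
  · exact abs_coeffA_le m θ
  · exact hVC _
  · exact abs_coeffB_le m θ
  · exact hVC' _

/-- The oscillating factor has derivative 2πiμ sin θ times itself, and sin θ is exactly the Jacobian
of x = cos θ. The boundary terms vanish because sin(mθ) does at 0 and π. -/
theorem integral_byParts (hV : ∀ v, HasDerivAt V (V' v) v) (hV' : Continuous V')
    (hVC : ∀ v, ‖V v‖ ≤ C) (hVC' : ∀ v, ‖V' v‖ ≤ C) (m : ℕ) (c μ : ℝ) :
    2 * π * μ * Complex.I * ∫ θ in Ioo 0 π, sin θ * (sin (m * θ) * V (c - log (sin θ)) * osc μ θ) =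
      -∫ θ in Ioo 0 π, osc μ θ * (coeffA m θ * V (c - log (sin θ)) +
        coeffB m θ * V' (c - log (sin θ))) := by
  have hVc : Continuous V := continuous_iff_continuousAt.2 fun v => (hV v).continuousAt
  have hC : 0 ≤ C := (norm_nonneg _).trans (hVC 0)
  set P : ℝ → ℂ := fun θ => sin (m * θ) * V (c - log (sin θ)) * osc μ θ with hP
  set Q : ℝ → ℂ := fun θ => osc μ θ * (coeffA m θ * V (c - log (sin θ)) +
    coeffB m θ * V' (c - log (sin θ))) with hQ
  have hPn : ∀ θ, ‖P θ‖ ≤ |sin (m * θ)| * C := fun θ => by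
    rw [hP]
    simp only [norm_mul, norm_osc, mul_one, Complex.norm_real, Real.norm_eq_abs]
    gcongr
    exact hVC _
  -- At the endpoints log(sin θ) diverges and V need not have a limit; boundedness of V and the zero
  -- of sin(mθ) suffice.
  have hPz : ∀ θ, sin (m * θ) = 0 → ContinuousAt P θ := by
    intro θ hθ
    have h0 : P θ = 0 := by simp only [hP, hθ]; simp
    rw [ContinuousAt, h0]
    refine squeeze_zero_norm hPn ?_
    have : Continuous fun θ : ℝ => |sin (m * θ)| * C := by fun_prop
    simpa [hθ] using this.tendsto θ
  have hPd : ∀ θ ∈ Ioo 0 π, HasDerivAt P (Q θ + 2 * π * μ * Complex.I * (sin θ * P θ)) θ := by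
    intro θ hθ
    have hs := (sin_pos_of_mem_Ioo hθ).ne'
    have h1 : HasDerivAt (fun θ : ℝ => ((sin (m * θ) : ℝ) : ℂ)) ((cos (m * θ) * m : ℝ) : ℂ) θ := by
      have h := ((hasDerivAt_id θ).const_mul (m : ℝ)).sin.ofReal_comp
      simpa using h
    have h2 : HasDerivAt (fun θ => V (c - log (sin θ)))
        ((-(cos θ / sin θ) : ℝ) • V' (c - log (sin θ))) θ := by
      have h := ((hasDerivAt_sin θ).log hs).const_sub c
      exact (hV _).scomp θ h
    have h3 := (h1.mul h2).mul (hasDerivAt_osc μ θ)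
    refine h3.congr_deriv ?_
    simp only [hQ, hP, coeffA, coeffB, Complex.real_smul, Pi.mul_apply]
    push_cast
    ring
  have hPc : ContinuousOn P (Icc 0 π) := by
    intro θ hθ
    rcases eq_or_lt_of_le hθ.1 with h | h
    · exact (hPz θ (by simp [← h])).continuousWithinAt
    rcases eq_or_lt_of_le hθ.2 with h' | h'
    · exact (hPz θ (by rw [h']; exact sin_nat_mul_pi m)).continuousWithinAt
    exact (hPd θ ⟨h, h'⟩).continuousAt.continuousWithinAt
  have hQi : IntegrableOn Q (Ioo 0 π) := by
    refine Integrable.of_bound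
      ((continuousOn_byParts hVc hV' m c μ).aestronglyMeasurable measurableSet_Ioo) (m * C + m * C)
      (.of_forall fun θ => norm_byParts_le hVC hVC' m c μ θ)
  have hRi : IntegrableOn (fun θ => (sin θ : ℂ) * P θ) (Ioo 0 π) := by
    have hsc : Continuous fun θ : ℝ => (sin θ : ℂ) := by fun_prop
    refine Integrable.of_bound
      ((hsc.continuousOn.mul (hPc.mono Ioo_subset_Icc_self)).aestronglyMeasurable
        measurableSet_Ioo) C (.of_forall fun θ => ?_)
    rw [norm_mul, Complex.norm_real]
    calc ‖sin θ‖ * ‖P θ‖ ≤ 1 * (1 * C) := by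
          gcongr
          · exact abs_sin_le_one θ
          · exact (hPn θ).trans (by gcongr; exact abs_sin_le_one _)
      _ = C := by ring
  have hsum := hQi.add (hRi.const_mul (2 * π * μ * Complex.I))
  have hii : IntervalIntegrable (fun θ => Q θ + 2 * π * μ * Complex.I * (sin θ * P θ))
      volume 0 π := by
    rw [intervalIntegrable_iff_integrableOn_Ioo_of_le pi_pos.le]
    exact hsum
  have h := intervalIntegral.integral_eq_sub_of_hasDerivAt_of_le pi_pos.le hPc hPd hii
  rw [intervalIntegral.integral_of_le pi_pos.le, integral_Ioc_eq_integral_Ioo,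
    integral_add hQi (hRi.const_mul _), integral_const_mul] at h
  have h0 : P π - P 0 = 0 := by
    simp only [hP, sin_nat_mul_pi]
    simp
  rw [h0] at h
  linear_combination h

end

theorem integral_Ioo_cos (g : ℝ → ℂ) :
    ∫ x in (-1 : ℝ)..1, g x = ∫ θ in Ioo 0 π, (sin θ : ℂ) * g (cos θ) := by
  have himg : cos '' Ioo 0 π = Ioo (-1) 1 := by
    ext x
    constructor
    · rintro ⟨θ, hθ, rfl⟩
      constructor
      · rw [← cos_pi]
        exact strictAntiOn_cos ⟨hθ.1.le, hθ.2.le⟩ ⟨pi_pos.le, le_rfl⟩ hθ.2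
      · rw [← cos_zero]
        exact strictAntiOn_cos ⟨le_rfl, pi_pos.le⟩ ⟨hθ.1.le, hθ.2.le⟩ hθ.1
    · intro hx
      exact ⟨arccos x, ⟨arccos_pos.2 hx.2, arccos_lt_pi.2 hx.1⟩, cos_arccos hx.1.le hx.2.le⟩
  rw [intervalIntegral.integral_of_le (by norm_num), integral_Ioc_eq_integral_Ioo, ← himg,
    integral_image_eq_integral_abs_deriv_smul measurableSet_Ioo
      (fun θ _ => (hasDerivAt_cos θ).hasDerivWithinAt) (injOn_cos.mono Ioo_subset_Icc_self)]
  refine setIntegral_congr_fun measurableSet_Ioo fun θ hθ => ?_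
  rw [abs_neg, abs_of_pos (sin_pos_of_mem_Ioo hθ), Complex.real_smul]

theorem thetaInf_cos (k : ℕ) {θ : ℝ} (hθ : θ ∈ Ioo 0 π) :
    thetaInf k (cos θ) = -(1 / (π : ℂ)) * (sin (((k - 1 : ℕ) : ℝ) * θ) : ℝ) := by
  have hs := sin_pos_of_mem_Ioo hθ
  have h1 : |cos θ| < 1 := by
    rw [← sq_lt_one_iff_abs_lt_one]
    nlinarith [sin_sq_add_cos_sq θ]
  have h2 : sqrt (1 - cos θ ^ 2) = sin θ := by
    rw [← sin_sq, sqrt_sq hs.le]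
  have hπ : (π : ℂ) ≠ 0 := by exact_mod_cast pi_ne_zero
  rw [thetaInf, if_pos h1, h2]
  push_cast
  have e1 : Complex.cos θ + Complex.I * Complex.sin θ = Complex.exp (θ * Complex.I) := by
    rw [Complex.exp_mul_I]; ring
  have e2 : Complex.cos θ - Complex.I * Complex.sin θ = Complex.exp (-θ * Complex.I) := by
    rw [Complex.exp_mul_I, Complex.cos_neg, Complex.sin_neg]; ring
  rw [e1, e2, ← Complex.exp_nat_mul, ← Complex.exp_nat_mul, Complex.sin]
  field_simp
  ring_nf

theorem continuous_deriv_weight : Continuous (deriv weight) :=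
  (contDiff_weight.of_le (m := 1) (by simp)).continuous_deriv le_rfl

theorem hasDerivAt_weight (v : ℝ) : HasDerivAt weight (deriv weight v) v :=
  (contDiff_weight.differentiable (by simp) v).hasDerivAt

theorem exists_weight_le : ∃ C, (∀ v, ‖weight v‖ ≤ C) ∧ ∀ v, ‖deriv weight v‖ ≤ C := by
  obtain ⟨C, hC⟩ := exists_iteratedDeriv_weight_le 0
  obtain ⟨D, hD⟩ := exists_iteratedDeriv_weight_le 1
  rw [iteratedDeriv_zero] at hC
  rw [iteratedDeriv_one] at hD
  exact ⟨max C D, fun v => (hC v).trans (le_max_left _ _), fun v => (hD v).trans (le_max_right _ _)⟩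

/-- `I_{l,f}(ξ,y)` after the substitution `x = cos θ` and an integration by parts. -/
theorem I_eq (k : ℕ) {l f : ℕ} (hl : 1 ≤ l) (hf : 1 ≤ f) {ξ : ℤ} (hξ : ξ ≠ 0) {y : ℝ}
    (hy : 0 < y) :
    I k l f ξ y = 1 / (2 * π ^ 2 * (ξ * sqrt y / (2 * (l * f ^ 2)) : ℝ) * Complex.I) *
      ∫ θ in Ioo 0 π, osc (ξ * sqrt y / (2 * (l * f ^ 2))) θ *
        (coeffA (k - 1) θ * weight (log (l * f ^ 2 / sqrt (4 * y)) - log (sin θ)) +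
          coeffB (k - 1) θ * deriv weight (log (l * f ^ 2 / sqrt (4 * y)) - log (sin θ))) := by
  obtain ⟨C, hC, hC'⟩ := exists_weight_le
  set μ : ℝ := ξ * sqrt y / (2 * (l * f ^ 2)) with hμ
  set c : ℝ := log (l * f ^ 2 / sqrt (4 * y)) with hc
  have hl0 : (0 : ℝ) < l := by exact_mod_cast hl
  have hf0 : (0 : ℝ) < f := by exact_mod_cast hf
  have hq : (0 : ℝ) < l * f ^ 2 / sqrt (4 * y) := by positivity
  have hμ0 : μ ≠ 0 := by
    have : (ξ : ℝ) ≠ 0 := by exact_mod_cast hξ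
    positivity
  have h := integral_byParts hasDerivAt_weight continuous_deriv_weight hC hC' (k - 1) c μ
  rw [← neg_eq_iff_eq_neg] at h
  rw [← h, I, integral_Ioo_cos]
  have hπ : (π : ℂ) ≠ 0 := by exact_mod_cast pi_ne_zero
  have hμ' : (μ : ℂ) ≠ 0 := by exact_mod_cast hμ0
  have h2 : ∀ J : ℂ, 1 / (2 * π ^ 2 * μ * Complex.I) * -(2 * π * μ * Complex.I * J) =
      -(1 / (π : ℂ)) * J := fun J => by
    field_simp
  rw [h2, ← integral_const_mul]
  refine setIntegral_congr_fun measurableSet_Ioo fun θ hθ => ?_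
  have hs := sin_pos_of_mem_Ioo hθ
  have h3 : sqrt (1 - cos θ ^ 2) = sin θ := by
    rw [← sin_sq, sqrt_sq hs.le]
  have h4 : exp (c - log (sin θ)) = l * f ^ 2 / sqrt (4 * y) / sin θ := by
    rw [exp_sub, hc, exp_log hq, exp_log hs]
  have h5 : e (-(cos θ * ξ * sqrt y) / (2 * l * f ^ 2)) = osc μ θ := by
    rw [e, osc]
    congr 1
    rw [hμ]
    push_cast
    ring
  simp only [thetaInf_cos k hθ, h3, h5, weight, h4]
  ring

/-! ### Derivatives of the amplitude -/

/-- A smooth function with all derivatives bounded. -/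
structure SmoothBounded (V : ℝ → ℂ) : Prop where
  contDiff : ContDiff ℝ ∞ V
  bounded : ∀ n, ∃ C, ∀ v, ‖iteratedDeriv n V v‖ ≤ C

theorem SmoothBounded.deriv {V : ℝ → ℂ} (hV : SmoothBounded V) : SmoothBounded (deriv V) where
  contDiff := (contDiff_infty_iff_deriv.1 hV.contDiff).2
  bounded n := by
    obtain ⟨C, hC⟩ := hV.bounded (n + 1)
    exact ⟨C, fun v => by rw [← iteratedDeriv_succ']; exact hC v⟩

theorem smoothBounded_weight : SmoothBounded weight :=
  ⟨contDiff_weight, exists_iteratedDeriv_weight_le⟩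

/-- A smooth function supported in `[1/4, 5/4]`. -/
structure Bump (g : ℝ → ℂ) : Prop where
  contDiff : ContDiff ℝ ∞ g
  tsupport_subset : tsupport g ⊆ Icc (1 / 4) (5 / 4)

namespace Bump

variable {g : ℝ → ℂ}

theorem deriv (hg : Bump g) : Bump (deriv g) where
  contDiff := (contDiff_infty_iff_deriv.1 hg.contDiff).2
  tsupport_subset := (closure_mono support_deriv_subset).trans
    ((isClosed_tsupport g).closure_eq.subset.trans hg.tsupport_subset)

theorem eq_zero (hg : Bump g) {z : ℝ} (hz : z ∉ Icc (1 / 4 : ℝ) (5 / 4)) : g z = 0 :=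
  image_eq_zero_of_notMem_tsupport fun h => hz (hg.tsupport_subset h)

theorem eventually_eq_zero (hg : Bump g) {z : ℝ} (hz : z ≤ 0) : ∀ᶠ w in 𝓝 z, g w = 0 := by
  filter_upwards [gt_mem_nhds (show z < 1 / 4 by linarith)] with w hw
  exact hg.eq_zero fun h => absurd h.1 (not_le.2 hw)

theorem hasCompactSupport (hg : Bump g) : HasCompactSupport g :=
  isCompact_Icc.of_isClosed_subset (isClosed_tsupport g) hg.tsupport_subset

end Bump

/-- The amplitude `g(z) e^{iμ√z} V(c - ½ log z) z^{-b}`. -/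
noncomputable def amp (g V : ℝ → ℂ) (μ c b z : ℝ) : ℂ :=
  g z * Complex.exp ((μ * sqrt z : ℝ) * Complex.I) * V (c - 1 / 2 * log z) * (z ^ (-b) : ℝ)

section

variable {g V : ℝ → ℂ}

theorem hasDerivAt_amp (hg : Bump g) (hV : SmoothBounded V) (μ c b z : ℝ) :
    HasDerivAt (amp g V μ c b)
      (amp (deriv g) V μ c b z + (μ / 2 * Complex.I) * amp g V μ c (b + 1 / 2) z +
        (-(1 / 2)) * amp g (deriv V) μ c (b + 1) z + (-b) * amp g V μ c (b + 1) z) z := by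
  -- For z ≤ 0 the bump vanishes near z, so the values of √, log and real powers there play no role.
  rcases le_or_gt z 0 with hz | hz
  · have h0 := hg.eventually_eq_zero hz
    have h1 : amp g V μ c b =ᶠ[𝓝 z] fun _ => 0 := by
      filter_upwards [h0] with w hw
      simp [amp, hw]
    have h2 := hg.deriv.eventually_eq_zero hz
    refine HasDerivAt.congr_of_eventuallyEq ?_ h1
    simp only [amp, h0.self_of_nhds, h2.self_of_nhds]
    simpa using hasDerivAt_const z (0 : ℂ)
  · have d1 : HasDerivAt g (deriv g z) z := (hg.contDiff.differentiable (by simp) z).hasDerivAt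
    have d2 : HasDerivAt (fun z : ℝ => Complex.exp ((μ * sqrt z : ℝ) * Complex.I))
        (Complex.exp ((μ * sqrt z : ℝ) * Complex.I) *
          ((μ * (1 / (2 * sqrt z)) : ℝ) * Complex.I)) z :=
      ((((hasDerivAt_sqrt hz.ne').const_mul μ).ofReal_comp).mul_const Complex.I).cexp
    have d3 : HasDerivAt (fun z : ℝ => V (c - 1 / 2 * log z))
        ((-(1 / 2 * z⁻¹) : ℝ) • deriv V (c - 1 / 2 * log z)) z := by
      have h := ((hasDerivAt_log hz.ne').const_mul (1 / 2)).const_sub c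
      exact ((hV.contDiff.differentiable (by simp) _).hasDerivAt).scomp z h
    have d4 : HasDerivAt (fun z : ℝ => ((z ^ (-b) : ℝ) : ℂ)) ((-b * z ^ (-b - 1) : ℝ) : ℂ) z :=
      (hasDerivAt_rpow_const (Or.inl hz.ne')).ofReal_comp
    have d := ((d1.mul d2).mul d3).mul d4
    refine d.congr_deriv ?_
    have e1 : z ^ (-(b + 1 / 2)) = z ^ (-b) * (sqrt z)⁻¹ := by
      rw [neg_add, rpow_add hz, sqrt_eq_rpow, ← rpow_neg hz.le]
    have e2 : z ^ (-(b + 1)) = z ^ (-b) * z⁻¹ := by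
      rw [neg_add, rpow_add hz, rpow_neg_one]
    have e3 : z ^ (-b - 1) = z ^ (-b) * z⁻¹ := by
      rw [sub_eq_add_neg, rpow_add hz, rpow_neg_one]
    simp only [amp, e1, e2, e3, Complex.real_smul, Pi.mul_apply]
    push_cast
    have : (sqrt z : ℂ) ≠ 0 := by exact_mod_cast (sqrt_pos.2 hz).ne'
    field_simp

theorem deriv_amp (hg : Bump g) (hV : SmoothBounded V) (μ c b : ℝ) :
    deriv (amp g V μ c b) = fun z =>
      amp (deriv g) V μ c b z + (μ / 2 * Complex.I) * amp g V μ c (b + 1 / 2) z +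
        (-(1 / 2)) * amp g (deriv V) μ c (b + 1) z + (-b) * amp g V μ c (b + 1) z :=
  funext fun z => (hasDerivAt_amp hg hV μ c b z).deriv

theorem contDiff_amp_nat (n : ℕ) (hg : Bump g) (hV : SmoothBounded V) (μ c b : ℝ) :
    ContDiff ℝ n (amp g V μ c b) := by
  induction n generalizing g V b with
  | zero =>
    refine contDiff_zero.2 (continuous_iff_continuousAt.2 fun z => ?_)
    exact (hasDerivAt_amp hg hV μ c b z).continuousAt
  | succ n ih =>
    push_cast
    rw [contDiff_succ_iff_deriv]
    refine ⟨fun z => (hasDerivAt_amp hg hV μ c b z).differentiableAt, by simp, ?_⟩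
    rw [deriv_amp hg hV]
    exact (((ih hg.deriv hV b).add (contDiff_const.mul (ih hg hV _))).add
      (contDiff_const.mul (ih hg hV.deriv _))).add (contDiff_const.mul (ih hg hV _))

theorem bump_amp (hg : Bump g) (hV : SmoothBounded V) (μ c b : ℝ) : Bump (amp g V μ c b) where
  contDiff := contDiff_infty.2 fun n => contDiff_amp_nat n hg hV μ c b
  tsupport_subset := by
    refine (closure_mono fun z hz => ?_).trans hg.tsupport_subset
    contrapose! hz
    simp only [Function.mem_support, not_not] at hz
    simp [amp, hz]

theorem exists_norm_amp_le (hV : SmoothBounded V) (b : ℝ) (hb : 0 ≤ b) :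
    ∃ C, 0 ≤ C ∧ ∀ g, Bump g → ∀ μ c z, ‖amp g V μ c b z‖ ≤ C * ‖g z‖ := by
  obtain ⟨C, hC⟩ := hV.bounded 0
  rw [iteratedDeriv_zero] at hC
  have hC0 : 0 ≤ C := (norm_nonneg _).trans (hC 0)
  refine ⟨C * (1 / 4) ^ (-b), by positivity, fun g hg μ c z => ?_⟩
  by_cases hz : z ∈ Icc (1 / 4 : ℝ) (5 / 4)
  · have hz0 : 0 < z := by linarith [hz.1]
    rw [amp, norm_mul, norm_mul, norm_mul, Complex.norm_exp_ofReal_mul_I, mul_one,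
      Complex.norm_real, Real.norm_of_nonneg (by positivity)]
    have h1 : z ^ (-b) ≤ (1 / 4 : ℝ) ^ (-b) :=
      rpow_le_rpow_of_nonpos (by norm_num) hz.1 (by linarith)
    calc ‖g z‖ * ‖V (c - 1 / 2 * log z)‖ * z ^ (-b) ≤ ‖g z‖ * C * (1 / 4) ^ (-b) := by
          gcongr
          exact hC _
      _ = _ := by ring
  · simp [amp, hg.eq_zero hz]

/-- A derivative falls on g, on the phase (cost |μ|/2 and z^(-1/2)), on V or on the power of z, and
each result is again an amplitude. The exponent b and the function V are therefore general in the
induction. The constant is uniform in μ and c because only sup norms of derivatives of V enter and z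
≥ 1/4 on the support. -/
theorem exists_iteratedDeriv_amp_le (j : ℕ) (hV : SmoothBounded V) (b : ℝ) (hb : 0 ≤ b) :
    ∃ C, 0 ≤ C ∧ ∀ g, Bump g → ∀ μ c z, ‖iteratedDeriv j (amp g V μ c b) z‖ ≤
      C * (1 + |μ|) ^ j * ∑ i ∈ Finset.range (j + 1), ‖iteratedDeriv i g z‖ := by
  induction j generalizing V b with
  | zero =>
    obtain ⟨C, hC0, hC⟩ := exists_norm_amp_le hV b hb
    exact ⟨C, hC0, fun g hg μ c z => by simpa using hC g hg μ c z⟩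
  | succ j ih =>
    obtain ⟨C₁, h₁, H₁⟩ := ih hV b hb
    obtain ⟨C₂, h₂, H₂⟩ := ih hV (b + 1 / 2) (by linarith)
    obtain ⟨C₃, h₃, H₃⟩ := ih hV.deriv (b + 1) (by linarith)
    obtain ⟨C₄, h₄, H₄⟩ := ih hV (b + 1) (by linarith)
    refine ⟨C₁ + C₂ + C₃ + b * C₄, by positivity, fun g hg μ c z => ?_⟩
    have cd : ∀ {g V : ℝ → ℂ}, Bump g → SmoothBounded V → ∀ b (a : ℂ),
        ContDiffAt ℝ j (fun z => a * amp g V μ c b z) z := fun hg hV b a =>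
      (contDiff_const.mul (contDiff_amp_nat j hg hV μ c b)).contDiffAt
    have cd' := (contDiff_amp_nat j hg.deriv hV μ c b).contDiffAt (x := z)
    rw [iteratedDeriv_succ', deriv_amp hg hV,
      iteratedDeriv_fun_add ((cd'.add (cd hg hV _ _)).add (cd hg hV.deriv _ _)) (cd hg hV _ _),
      iteratedDeriv_fun_add (cd'.add (cd hg hV _ _)) (cd hg hV.deriv _ _),
      iteratedDeriv_fun_add cd' (cd hg hV _ _),
      iteratedDeriv_const_mul_field, iteratedDeriv_const_mul_field, iteratedDeriv_const_mul_field]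
    set S := ∑ i ∈ Finset.range (j + 1 + 1), ‖iteratedDeriv i g z‖ with hS
    have hS1 : ∑ i ∈ Finset.range (j + 1), ‖iteratedDeriv i g z‖ ≤ S := by
      rw [hS, Finset.sum_range_succ _ (j + 1)]
      exact le_add_of_nonneg_right (norm_nonneg _)
    have hS2 : ∑ i ∈ Finset.range (j + 1), ‖iteratedDeriv i (deriv g) z‖ ≤ S := by
      rw [hS, Finset.sum_range_succ' _ (j + 1)]
      simp only [← iteratedDeriv_succ']
      exact le_add_of_nonneg_right (norm_nonneg _)
    set m := 1 + |μ| with hm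
    have hm1 : 1 ≤ m := by linarith [abs_nonneg μ]
    have hS0 : 0 ≤ S := Finset.sum_nonneg fun _ _ => norm_nonneg _
    have hX : ∀ {x C s : ℝ} {a : ℝ}, 0 ≤ C → x ≤ C * m ^ j * s → s ≤ S → 0 ≤ a → a ≤ m →
        a * x ≤ C * m ^ (j + 1) * S := by
      intro x C s a hC hx hs ha ham
      calc a * x ≤ a * (C * m ^ j * S) := by
            gcongr
            exact hx.trans (by gcongr)
        _ ≤ m * (C * m ^ j * S) := by gcongr
        _ = _ := by ring
    refine (norm_add_le _ _).trans ?_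
    refine (add_le_add_left ((norm_add_le _ _).trans (add_le_add_left (norm_add_le _ _) _)) _).trans
      ?_
    rw [norm_mul (_ * Complex.I) (iteratedDeriv _ _ _), norm_mul (-(1 / 2) : ℂ),
      norm_mul (-(b : ℂ))]
    have n1 := hX h₁ (H₁ _ hg.deriv μ c z) hS2 zero_le_one hm1
    have n2 := hX (a := ‖(μ / 2 * Complex.I : ℂ)‖) h₂ (H₂ _ hg μ c z) hS1 (norm_nonneg _) (by
      rw [norm_mul, Complex.norm_I, norm_div, Complex.norm_real, Real.norm_eq_abs, hm]
      norm_num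
      linarith [abs_nonneg μ])
    have n3 := hX (a := ‖(-(1 / 2) : ℂ)‖) h₃ (H₃ _ hg μ c z) hS1 (norm_nonneg _) (by
      norm_num
      linarith)
    have n4 := hX h₄ (H₄ _ hg μ c z) hS1 zero_le_one hm1
    have nb : ‖(-b : ℂ)‖ = b := by rw [norm_neg, Complex.norm_real, Real.norm_of_nonneg hb]
    rw [nb]
    have n5 := mul_le_mul_of_nonneg_left n4 hb
    linarith

theorem Bump.integrable_iteratedDeriv (hg : Bump g) (n : ℕ) : Integrable (iteratedDeriv n g) := by
  refine Continuous.integrable_of_hasCompactSupport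
    (hg.contDiff.continuous_iteratedDeriv n (by exact_mod_cast le_top)) ?_
  induction n generalizing g with
  | zero => simpa using hg.hasCompactSupport
  | succ n ih => rw [iteratedDeriv_succ']; exact ih hg.deriv

theorem exists_integral_iteratedDeriv_amp_le (j : ℕ) (hV : SmoothBounded V) :
    ∃ C, 0 ≤ C ∧ ∀ g, Bump g → ∀ μ c, ∫ z, ‖iteratedDeriv j (amp g V μ c 0) z‖ ≤
      C * (1 + |μ|) ^ j * sobolevNorm j g := by
  obtain ⟨C, hC0, hC⟩ := exists_iteratedDeriv_amp_le j hV 0 le_rfl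
  refine ⟨C, hC0, fun g hg μ c => ?_⟩
  have hi : ∀ i ∈ Finset.range (j + 1), Integrable fun z => ‖iteratedDeriv i g z‖ :=
    fun i _ => (hg.integrable_iteratedDeriv i).norm
  rw [sobolevNorm, ← integral_finsetSum _ hi, ← integral_const_mul]
  exact integral_mono ((bump_amp hg hV μ c 0).integrable_iteratedDeriv j).norm
    ((integrable_finsetSum _ hi).const_mul _) fun z => hC g hg μ c z

theorem sobolevNorm_mono {m n : ℕ} (h : m ≤ n) (g : ℝ → ℂ) : sobolevNorm m g ≤ sobolevNorm n g :=
  Finset.sum_le_sum_of_subset_of_nonneg (Finset.range_mono (by omega))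
    fun _ _ _ => integral_nonneg fun _ => norm_nonneg _

theorem sobolevNorm_nonneg (n : ℕ) (g : ℝ → ℂ) : 0 ≤ sobolevNorm n g :=
  Finset.sum_nonneg fun _ _ => integral_nonneg fun _ => norm_nonneg _

end

/-! ### Poisson summation -/

/-- The constant of the Poisson estimate. -/
noncomputable def poissonConst : ℝ := ∑' m : ℤ, 1 / (m : ℝ) ^ 2

/-- The M derivatives give |2πm|^(-M); only m^(-2) is kept, enough for summability over m, and this
is where M ≥ 2 enters. -/
theorem norm_fourier_le {f : ℝ → ℂ} (hf : ContDiff ℝ ∞ f)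
    (hi : ∀ n, Integrable (iteratedDeriv n f)) {M : ℕ} (hM : 2 ≤ M) {m : ℤ} (hm : m ≠ 0) :
    ‖𝓕 f (m : ℝ)‖ ≤ 1 / (m : ℝ) ^ 2 * ∫ x, ‖iteratedDeriv M f x‖ := by
  have hm1 : 1 ≤ |(m : ℝ)| := by exact_mod_cast Int.one_le_abs hm
  have h := congrFun (Real.fourier_iteratedDeriv (N := ⊤) (n := M) hf (fun n _ => hi n) le_top)
    (m : ℝ)
  have h1 : ‖𝓕 (iteratedDeriv M f) (m : ℝ)‖ ≤ ∫ x, ‖iteratedDeriv M f x‖ := by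
    rw [Real.fourier_eq]
    refine (norm_integral_le_integral_norm _).trans (le_of_eq ?_)
    simp only [Circle.norm_smul]
  rw [h, norm_smul, norm_pow] at h1
  have h2 : |(m : ℝ)| ≤ ‖(2 * π * Complex.I * (m : ℝ) : ℂ)‖ := by
    simp only [norm_mul, Complex.norm_I, Complex.norm_real, Complex.norm_ofNat, mul_one,
      Real.norm_eq_abs, abs_of_pos pi_pos]
    nlinarith [pi_gt_three]
  have h3 : (m : ℝ) ^ 2 ≤ ‖(2 * π * Complex.I * (m : ℝ) : ℂ)‖ ^ M := by
    calc (m : ℝ) ^ 2 = |(m : ℝ)| ^ 2 := (sq_abs _).symm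
      _ ≤ |(m : ℝ)| ^ M := pow_le_pow_right₀ hm1 hM
      _ ≤ _ := by gcongr
  have hm2 : 0 < (m : ℝ) ^ 2 := by positivity
  rw [one_div, inv_mul_eq_div, le_div_iff₀ hm2, mul_comm]
  exact (mul_le_mul_of_nonneg_right h3 (norm_nonneg _)).trans h1

theorem norm_tsum_sub_integral_le {f : ℝ → ℂ} (hf : ContDiff ℝ ∞ f) (hc : HasCompactSupport f)
    (hi : ∀ n, Integrable (iteratedDeriv n f)) {M : ℕ} (hM : 2 ≤ M) :
    ‖∑' r : ℤ, f r - ∫ x, f x‖ ≤ poissonConst * ∫ x, ‖iteratedDeriv M f x‖ := by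
  have hP := SchwartzMap.tsum_eq_tsum_fourier (hc.toSchwartzMap hf) 0
  simp only [zero_add, HasCompactSupport.toSchwartzMap_toFun, SchwartzMap.fourier_coe] at hP
  have hco : ((hc.toSchwartzMap hf : SchwartzMap ℝ ℂ) : ℝ → ℂ) = f := rfl
  have hsum : Summable fun m : ℤ => 1 / (m : ℝ) ^ 2 := by
    simpa using Real.summable_one_div_int_pow.2 one_lt_two
  set B := ∫ x, ‖iteratedDeriv M f x‖
  -- At m = 0 both sides are 0, since 1 / 0 = 0; accordingly `poissonConst` has no contribution from
  -- m = 0.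
  have hbd : ∀ m : ℤ, ‖𝓕 f (m : ℝ) - if m = 0 then 𝓕 f 0 else 0‖ ≤ 1 / (m : ℝ) ^ 2 * B := by
    intro m
    rcases eq_or_ne m 0 with rfl | hm
    · simp
    · simpa [hm] using norm_fourier_le hf hi hM hm
  have hs1 : Summable fun m : ℤ => 𝓕 f (m : ℝ) - if m = 0 then 𝓕 f 0 else 0 :=
    Summable.of_norm_bounded (hsum.mul_right B) hbd
  have hs0 : Summable fun m : ℤ => if m = 0 then 𝓕 f (0 : ℝ) else 0 :=
    (hasSum_ite_eq 0 _).summable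
  have hs : ∑' m : ℤ, 𝓕 f (m : ℝ) - ∫ x, f x =
      ∑' m : ℤ, (𝓕 f (m : ℝ) - if m = 0 then 𝓕 f 0 else 0) := by
    have hs2 : Summable fun m : ℤ => 𝓕 f (m : ℝ) := by
      simpa using hs1.add hs0
    rw [hs2.tsum_sub hs0, tsum_ite_eq]
    congr 1
    simp [Real.fourier_eq]
  have hL : ∑' r : ℤ, f r = ∑' m : ℤ, 𝓕 f (m : ℝ) := by
    rw [hco] at hP
    simpa using hP
  rw [hL, hs, poissonConst, ← tsum_mul_right]
  exact tsum_of_norm_bounded (hsum.mul_right B).hasSum hbd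

/-- The sum of `T(n/X)` over a residue class modulo `q` compared with its mean value. -/
theorem norm_tsum_class_sub_le {T : ℝ → ℂ} (hT : Bump T) {q X : ℝ} (hq : 0 < q) (hX : 0 < X)
    (b : ℝ) {M : ℕ} (hM : 2 ≤ M) :
    ‖∑' r : ℤ, T ((b + q * r) / X) - (X / q : ℝ) * ∫ z, T z‖ ≤
      poissonConst * ((q / X) ^ M * (X / q) * ∫ z, ‖iteratedDeriv M T z‖) := by
  have hqX : 0 < q / X := by positivity
  set f : ℝ → ℂ := fun x => T (b / X + q / X * x) with hf
  have hcd : ContDiff ℝ ∞ f := hT.contDiff.comp (by fun_prop)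
  have hder : ∀ n, iteratedDeriv n f =
      fun x => (q / X) ^ n • iteratedDeriv n T (b / X + q / X * x) := by
    intro n
    have h1 := iteratedDeriv_comp_const_smul (n := n) (f := fun x => T (b / X + x))
      ((hT.contDiff.comp (by fun_prop)).of_le (by exact_mod_cast le_top)) (q / X)
    rw [iteratedDeriv_comp_const_add] at h1
    exact h1
  have hcs : HasCompactSupport f := by
    have := hT.hasCompactSupport.comp_homeomorph
      ((Homeomorph.mulLeft₀ (q / X) hqX.ne').trans (Homeomorph.addLeft (b / X)))
    exact this
  have hi : ∀ n, Integrable (iteratedDeriv n f) := by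
    intro n
    rw [hder n]
    exact (((hT.integrable_iteratedDeriv n).comp_add_left (b / X)).comp_mul_left' hqX.ne').smul
      ((q / X) ^ n)
  -- The target is general because the change of variables is used both for `T` and for the norm of
  -- its derivative.
  have hI : ∀ {E : Type} [NormedAddCommGroup E] [NormedSpace ℝ E] (u : ℝ → E),
      ∫ x, u (b / X + q / X * x) = (X / q) • ∫ z, u z := by
    intro E _ _ u
    rw [Measure.integral_comp_mul_left (fun x => u (b / X + x)), integral_add_left_eq_self,
      abs_of_pos (by positivity), inv_div]
  have h := norm_tsum_sub_integral_le hcd hcs hi hM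
  have e1 : ∑' r : ℤ, f r = ∑' r : ℤ, T ((b + q * r) / X) := by
    refine tsum_congr fun r => ?_
    rw [hf]
    field_simp
  have e2 : ∫ x, f x = (X / q : ℝ) * ∫ z, T z := by
    rw [hf, hI T, Complex.real_smul]
  have e3 : ∫ x, ‖iteratedDeriv M f x‖ = (q / X) ^ M * (X / q) * ∫ z, ‖iteratedDeriv M T z‖ := by
    rw [hder M]
    simp only [norm_smul, norm_pow, Real.norm_of_nonneg hqX.le]
    rw [integral_const_mul, hI (fun z => ‖iteratedDeriv M T z‖), smul_eq_mul, mul_assoc]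
  rwa [e1, e2, e3] at h

/-! ### Periodicity and mean value of `Kl` -/

/-- The odd part of l divides l, which settles the Jacobi symbol. The factor 4 serves the prime 2:
if l is even then 8 divides 4l, and if l is odd the power of χ₈ is trivial. -/
theorem kronecker_add (x j : ℤ) (l : ℕ) : kronecker (x + 4 * l * j) l = kronecker x l := by
  unfold kronecker
  set v := l.factorization 2
  have hdvd : 2 ^ v ∣ l := Nat.ordProj_dvd l 2
  congr 1
  · rcases Nat.eq_zero_or_pos v with h | h
    · simp [h]
    · have h2 : 2 ∣ l := (dvd_pow_self 2 h.ne').trans hdvd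
      obtain ⟨m, rfl⟩ := h2
      congr 2
      have : (8 : ZMod 8) = 0 := by decide
      push_cast
      linear_combination (m : ZMod 8) * j * this
  · obtain ⟨m, hm⟩ := Nat.div_dvd_of_dvd hdvd
    rw [jacobiSym.mod_left (x + 4 * l * j), jacobiSym.mod_left x]
    congr 1
    have : x + 4 * (l : ℤ) * j = x + ((l / 2 ^ v : ℕ) : ℤ) * (4 * (m : ℤ) * j) := by
      conv_lhs => rw [hm]
      push_cast
      ring
    rw [this, Int.add_mul_emod_self_left]

theorem abs_kronecker_le (x : ℤ) (l : ℕ) : |kronecker x l| ≤ 1 := by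
  rw [kronecker, abs_mul, abs_pow]
  have h1 : |ZMod.χ₈ (x : ZMod 8)| ≤ 1 := by
    generalize (x : ZMod 8) = y
    revert y
    decide
  have h2 : |jacobiSym x (l / 2 ^ l.factorization 2)| ≤ 1 := by
    rcases jacobiSym.trichotomy x (l / 2 ^ l.factorization 2) with h | h | h <;> simp [h]
  exact mul_le_one₀ (pow_le_one₀ (abs_nonneg _) h1) (abs_nonneg _) h2

open Classical in
/-- The coefficient of `Kl` as a function of `a² - 4n`. -/
noncomputable def klCoeff (l f : ℕ) (D : ℤ) : ℂ :=
  if (f : ℤ) ^ 2 ∣ D ∧ (D / (f : ℤ) ^ 2 ≡ 0 [ZMOD 4] ∨ D / (f : ℤ) ^ 2 ≡ 1 [ZMOD 4]) then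
    (kronecker (D / (f : ℤ) ^ 2) l : ℂ) else 0

theorem klCoeff_add (l : ℕ) {f : ℕ} (hf : 1 ≤ f) (D j : ℤ) :
    klCoeff l f (D + 4 * (l * f ^ 2 : ℕ) * j) = klCoeff l f D := by
  have hf0 : (f : ℤ) ^ 2 ≠ 0 := by positivity
  have h1 : D + 4 * ((l * f ^ 2 : ℕ) : ℤ) * j = D + (f : ℤ) ^ 2 * (4 * l * j) := by
    push_cast; ring
  have h2 : (D + (f : ℤ) ^ 2 * (4 * l * j)) / (f : ℤ) ^ 2 = D / (f : ℤ) ^ 2 + 4 * l * j :=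
    Int.add_mul_ediv_left _ _ hf0
  have h3 : (f : ℤ) ^ 2 ∣ D + (f : ℤ) ^ 2 * (4 * l * j) ↔ (f : ℤ) ^ 2 ∣ D :=
    Int.dvd_add_left (Dvd.intro _ rfl)
  have h4 : ∀ r : ℤ, D / (f : ℤ) ^ 2 + 4 * l * j ≡ r [ZMOD 4] ↔ D / (f : ℤ) ^ 2 ≡ r [ZMOD 4] := by
    intro r
    have : D / (f : ℤ) ^ 2 + 4 * l * j ≡ D / (f : ℤ) ^ 2 [ZMOD 4] := by
      rw [mul_assoc]
      exact Int.add_mul_emod_self_left _ _ _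
    exact ⟨fun h => this.symm.trans h, fun h => this.trans h⟩
  rw [h1]
  unfold klCoeff
  simp only [h2, h3, h4, kronecker_add]

theorem norm_klCoeff_le (l f : ℕ) (D : ℤ) : ‖klCoeff l f D‖ ≤ 1 := by
  unfold klCoeff
  split_ifs
  · rw [Complex.norm_intCast]
    exact_mod_cast abs_kronecker_le _ _
  · simp

theorem norm_e (x : ℝ) : ‖e x‖ = 1 := by
  have : e x = Complex.exp ((2 * π * x : ℝ) * Complex.I) := by
    rw [e]
    congr 1
    push_cast
    ring
  rw [this, Complex.norm_exp_ofReal_mul_I]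

theorem e_add (x y : ℝ) : e (x + y) = e x * e y := by
  rw [e, e, e, ← Complex.exp_add]
  congr 1
  push_cast
  ring

theorem e_intCast (n : ℤ) : e n = 1 := by
  rw [e, Complex.exp_eq_one_iff]
  exact ⟨n, by push_cast; ring⟩

theorem e_ne_one {x : ℝ} (h0 : x ≠ 0) (h1 : |x| < 1) : e x ≠ 1 := by
  rw [e, Ne, Complex.exp_eq_one_iff]
  rintro ⟨n, hn⟩
  have h2 : (x : ℂ) = n := by
    have : (2 * (π : ℂ) * Complex.I) ≠ 0 := Complex.two_pi_I_ne_zero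
    refine mul_left_cancel₀ this ?_
    rw [hn]
    ring
  have h3 : x = n := by exact_mod_cast h2
  rw [h3] at h0 h1
  have h4 : |n| < 1 := by exact_mod_cast h1
  exact h0 (by rw [Int.abs_lt_one_iff.1 h4]; simp)

theorem Kl_eq (l f : ℕ) (ξ n : ℤ) :
    Kl l f ξ n = ∑ a ∈ Finset.range (4 * (l * f ^ 2)),
      klCoeff l f ((a : ℤ) ^ 2 - 4 * n) * e (((a : ℤ) : ℝ) * ξ / (4 * (l * f ^ 2 : ℕ))) := by
  rw [Kl, Finset.sum_filter, mul_assoc]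
  refine Finset.sum_congr rfl fun a _ => ?_
  unfold klCoeff
  push_cast
  split_ifs
  · rw [mul_assoc]
  · simp

theorem norm_Kl_le (l f : ℕ) (ξ n : ℤ) : ‖Kl l f ξ n‖ ≤ 4 * (l * f ^ 2 : ℕ) := by
  rw [Kl_eq]
  refine (norm_sum_le_of_le (n := fun _ => (1 : ℝ)) _ fun a _ => ?_).trans (le_of_eq (by simp))
  rw [norm_mul, norm_e, mul_one]
  exact norm_klCoeff_le _ _ _

theorem Kl_add (l : ℕ) {f : ℕ} (hf : 1 ≤ f) (ξ n j : ℤ) :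
    Kl l f ξ (n + (l * f ^ 2 : ℕ) * j) = Kl l f ξ n := by
  rw [Kl_eq, Kl_eq]
  refine Finset.sum_congr rfl fun a _ => ?_
  rw [← klCoeff_add l hf ((a : ℤ) ^ 2 - 4 * n) (-j)]
  congr 2
  ring

theorem sum_range_shift {h : ℤ → ℂ} {q : ℕ} (hp : ∀ n, h (n + q) = h n) (t : ℤ) :
    ∑ b ∈ Finset.range q, h (b + t) = ∑ b ∈ Finset.range q, h b := by
  have step : ∀ t : ℤ, ∑ b ∈ Finset.range q, h (b + (t + 1)) = ∑ b ∈ Finset.range q, h (b + t) := by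
    intro t
    have h1 := Finset.sum_range_succ (fun b : ℕ => h (b + t)) q
    rw [Finset.sum_range_succ'] at h1
    have h2 : h ((q : ℤ) + t) = h (((0 : ℕ) : ℤ) + t) := by
      rw [add_comm, hp]; simp
    rw [h2] at h1
    have h3 := add_right_cancel h1
    rw [← h3]
    refine Finset.sum_congr rfl fun b _ => ?_
    push_cast
    congr 1
    ring
  induction t using Int.induction_on with
  | zero => simp
  | succ t ih => rw [step, ih]
  | pred t ih => rw [← ih, ← step]; simp

/-- The mean value of `Kl` over a period vanishes unless `ξ` is a multiple of `2lf²`. -/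
theorem sum_Kl_eq_zero (l : ℕ) {f : ℕ} (hf : 1 ≤ f) {ξ : ℤ} (hξ : ξ ≠ 0)
    (hlt : |ξ| < 2 * (l * f ^ 2 : ℕ)) :
    ∑ b ∈ Finset.range (l * f ^ 2), Kl l f ξ b = 0 := by
  simp only [Kl_eq]
  rw [Finset.sum_comm]
  simp only [← Finset.sum_mul]
  set q := l * f ^ 2 with hq
  have hq0 : 0 < (q : ℝ) := by
    have : (0 : ℤ) < q := by linarith [abs_nonneg ξ]
    exact_mod_cast this
  set S : ℤ → ℂ := fun a => ∑ b ∈ Finset.range q, klCoeff l f (a ^ 2 - 4 * ((b : ℕ) : ℤ)) with hS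
  set E : ℤ → ℂ := fun a => e ((a : ℝ) * ξ / (4 * q)) with hE
  -- The identity (a + 2)² - 4(b + a + 1) = a² - 4b turns a shift of a by 2 into a shift of b by a +
  -- 1, which a sum over a full period does not see.
  have hS2 : ∀ a, S (a + 2) = S a := by
    intro a
    have := sum_range_shift (h := fun b => klCoeff l f (a ^ 2 - 4 * b)) (q := q) (fun n => by
      rw [← klCoeff_add l hf (a ^ 2 - 4 * n) (-1), ← hq]
      congr 1
      ring) (-(a + 1))
    rw [hS]
    simp only
    rw [← this]
    refine Finset.sum_congr rfl fun b _ => ?_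
    congr 1
    ring
  have hSq : ∀ a, S (a + (4 * q : ℕ)) = S a := by
    intro a
    refine Finset.sum_congr rfl fun b _ => ?_
    rw [← klCoeff_add l hf (a ^ 2 - 4 * b) (2 * a + 4 * q), ← hq]
    congr 1
    push_cast
    ring
  have hE2 : ∀ a, E (a + 2) = e (ξ / (2 * q)) * E a := by
    intro a
    rw [hE]
    simp only
    rw [← e_add]
    congr 1
    push_cast
    field_simp
    ring
  have hEq : ∀ a, E (a + (4 * q : ℕ)) = E a := by
    intro a
    rw [hE]
    simp only
    rw [show ((a + (4 * q : ℕ) : ℤ) : ℝ) * ξ / (4 * q) = (ξ : ℤ) + (a : ℝ) * ξ / (4 * q) by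
      push_cast; field_simp; ring, e_add, e_intCast, one_mul]
  -- Shifting a by 2 fixes the total sum and also multiplies it by e(ξ/2q), which differs from 1 as
  -- 0 < |ξ| < 2q.
  have key := sum_range_shift (h := fun a => S a * E a) (q := 4 * q)
    (fun a => by simp only [hSq, hEq]) 2
  simp only [hS2, hE2] at key
  have hω : e (ξ / (2 * q)) ≠ 1 := by
    refine e_ne_one ?_ ?_
    · have : (ξ : ℝ) ≠ 0 := by exact_mod_cast hξ
      positivity
    · rw [abs_div, abs_of_pos (show (0 : ℝ) < 2 * q by positivity), div_lt_one (by positivity)]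
      exact_mod_cast hlt
  have key2 : (e (ξ / (2 * q)) - 1) * ∑ a ∈ Finset.range (4 * q), S a * E a = 0 := by
    rw [sub_mul, one_mul, sub_eq_zero, Finset.mul_sum]
    conv_rhs => rw [← key]
    exact Finset.sum_congr rfl fun a _ => by ring
  exact (mul_eq_zero.1 key2).resolve_left (sub_ne_zero.2 hω)

/-! ### Sums over residue classes -/

theorem Bump.finite_support_int {T : ℝ → ℂ} (hT : Bump T) {X : ℝ} (hX : 0 < X) :
    (Function.support fun n : ℤ => T (n / X)).Finite := by
  refine (Set.finite_Icc (0 : ℤ) ⌈2 * X⌉).subset fun n hn => ?_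
  have h : (n : ℝ) / X ∈ Icc (1 / 4 : ℝ) (5 / 4) := by
    by_contra h
    exact hn (hT.eq_zero h)
  have h1 := (le_div_iff₀ hX).1 h.1
  have h2 := (div_le_iff₀ hX).1 h.2
  constructor
  · have : (0 : ℝ) ≤ n := by nlinarith
    exact_mod_cast this
  · have : (n : ℝ) ≤ ⌈2 * X⌉ := le_trans (by nlinarith) (Int.le_ceil _)
    exact_mod_cast this

theorem tsum_mul_periodic {φ K : ℤ → ℂ} (hφ : φ.support.Finite) {q : ℕ} (hq : 0 < q)
    (hK : ∀ n j, K (n + q * j) = K n) :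
    ∑' n, K n * φ n = ∑ b ∈ Finset.range q, K b * ∑' r : ℤ, φ (b + q * r) := by
  have : NeZero q := ⟨hq.ne'⟩
  have hs : Summable fun n => K n * φ n :=
    summable_of_hasFiniteSupport (hφ.subset fun n hn => right_ne_zero_of_mul hn)
  have e1 : ∀ p : ℤ × Fin q, (Int.divModEquiv q).symm p = (p.2 : ℕ) + q * p.1 := fun p => by
    rw [Int.divModEquiv_symm_apply]
    ring
  have hs' : Summable fun p => K ((Int.divModEquiv q).symm p) * φ ((Int.divModEquiv q).symm p) :=
    ((Int.divModEquiv q).symm.summable_iff (f := fun n => K n * φ n)).2 hs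
  rw [← (Int.divModEquiv q).symm.tsum_eq, hs'.tsum_prod' (fun r => Summable.of_finite)]
  simp only [tsum_fintype]
  rw [Summable.tsum_finsetSum]
  · rw [← Fin.sum_univ_eq_sum_range (fun b => K b * ∑' r : ℤ, φ (b + q * r))]
    refine Finset.sum_congr rfl fun b _ => ?_
    rw [← tsum_mul_left]
    refine tsum_congr fun r => ?_
    rw [e1, hK]
  · intro b _
    exact hs'.comp_injective (i := fun r => (r, b)) fun r s h => (Prod.ext_iff.1 h).1

/-- Every residue class has the same main term, so the main terms combine to the sum of K over a
period; the q errors are added in absolute value. -/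
theorem norm_tsum_periodic_le {T : ℝ → ℂ} (hT : Bump T) {K : ℤ → ℂ} {q : ℕ} (hq : 0 < q)
    (hK : ∀ n j, K (n + q * j) = K n) {B : ℝ} (hB : ∀ n, ‖K n‖ ≤ B) {X : ℝ} (hX : 0 < X) {M : ℕ}
    (hM : 2 ≤ M) :
    ‖∑' n : ℤ, K n * T (n / X)‖ ≤
      ‖∑ b ∈ Finset.range q, K b‖ * (X / q * ∫ z, ‖T z‖) +
        q * B * (poissonConst * ((q / X) ^ M * (X / q) * ∫ z, ‖iteratedDeriv M T z‖)) := by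
  have hq0 : (0 : ℝ) < q := by exact_mod_cast hq
  rw [tsum_mul_periodic (φ := fun n : ℤ => T (n / X)) (hT.finite_support_int hX) hq hK]
  set D := poissonConst * ((q / X) ^ M * (X / q) * ∫ z, ‖iteratedDeriv M T z‖) with hD
  set A : ℂ := (X / q : ℝ) * ∫ z, T z with hA
  have hcls : ∀ b : ℕ, ‖∑' r : ℤ, T (((b + q * r : ℤ) : ℝ) / X) - A‖ ≤ D := by
    intro b
    have := norm_tsum_class_sub_le hT hq0 hX b hM
    push_cast
    exact this
  have hAn : ‖A‖ ≤ X / q * ∫ z, ‖T z‖ := by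
    rw [hA, norm_mul, Complex.norm_real, Real.norm_of_nonneg (by positivity)]
    gcongr
    exact norm_integral_le_integral_norm _
  have hsplit : ∑ b ∈ Finset.range q, K b * ∑' r : ℤ, T (((b + q * r : ℤ) : ℝ) / X) =
      (∑ b ∈ Finset.range q, K b) * A +
        ∑ b ∈ Finset.range q, K b * (∑' r : ℤ, T (((b + q * r : ℤ) : ℝ) / X) - A) := by
    rw [Finset.sum_mul, ← Finset.sum_add_distrib]
    exact Finset.sum_congr rfl fun b _ => by ring
  rw [hsplit]
  refine (norm_add_le _ _).trans (add_le_add ?_ ?_)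
  · rw [norm_mul]
    gcongr
  · refine (norm_sum_le_of_le (n := fun _ => B * D) _ fun b _ => ?_).trans (le_of_eq ?_)
    · rw [norm_mul]
      exact mul_le_mul (hB _) (hcls b) (norm_nonneg _) ((norm_nonneg _).trans (hB 0))
    · simp [mul_assoc]

/-! ### The contribution of one triple `(l, f, ξ)` -/

/-- The indicator of the triples for which `Kl` may have a nonzero mean value. -/
noncomputable def meanIndicator (l f : ℕ) (ξ : ℤ) : ℝ :=
  if |ξ| < 2 * (l * f ^ 2 : ℕ) then 0 else 1

theorem meanIndicator_nonneg (l f : ℕ) (ξ : ℤ) : 0 ≤ meanIndicator l f ξ := by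
  unfold meanIndicator
  split_ifs <;> norm_num

theorem norm_sum_Kl_le (l : ℕ) {f : ℕ} (hf : 1 ≤ f) {ξ : ℤ} (hξ : ξ ≠ 0) :
    ‖∑ b ∈ Finset.range (l * f ^ 2), Kl l f ξ b‖ ≤
      (l * f ^ 2 : ℕ) * (4 * (l * f ^ 2 : ℕ)) * meanIndicator l f ξ := by
  unfold meanIndicator
  split_ifs with h
  · rw [sum_Kl_eq_zero l hf hξ h]
    simp
  · refine (norm_sum_le _ _).trans ((Finset.sum_le_card_nsmul _ _ (4 * (l * f ^ 2 : ℕ) : ℝ)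
      fun (b : ℕ) _ => norm_Kl_le l f ξ (b : ℤ)).trans (le_of_eq ?_))
    simp

theorem poissonConst_nonneg : 0 ≤ poissonConst := tsum_nonneg fun _ => by positivity

theorem exists_sum_amp_le {V : ℝ → ℂ} (hV : SmoothBounded V) {M : ℕ} (hM : 2 ≤ M) :
    ∃ C, 0 ≤ C ∧ ∀ G, Bump G → ∀ l f : ℕ, 1 ≤ l → 1 ≤ f → ∀ ξ : ℤ, ξ ≠ 0 → ∀ X : ℝ, 0 < X →
      ∀ μ c, ‖∑' n : ℤ, Kl l f ξ n * amp G V μ c 0 (n / X)‖ ≤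
        C * sobolevNorm M G * ((l * f ^ 2 : ℕ) * X) *
          (((l * f ^ 2 : ℕ) / X * (1 + |μ|)) ^ M + meanIndicator l f ξ) := by
  obtain ⟨C₀, h₀, H₀⟩ := exists_integral_iteratedDeriv_amp_le 0 hV
  obtain ⟨C₁, h₁, H₁⟩ := exists_integral_iteratedDeriv_amp_le M hV
  refine ⟨4 * (C₀ + poissonConst * C₁), by
    have := poissonConst_nonneg
    positivity, fun G hG l f hl hf ξ hξ X hX μ c => ?_⟩
  have hq : 0 < l * f ^ 2 := by positivity
  have hmean := norm_sum_Kl_le l hf hξ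
  have hKl := norm_Kl_le l f ξ
  have hper := Kl_add l hf ξ
  have hZ := meanIndicator_nonneg l f ξ
  set Z := meanIndicator l f ξ
  set q := l * f ^ 2 with hqdef
  have hq0 : (0 : ℝ) < q := by exact_mod_cast hq
  have hP := poissonConst_nonneg
  set S := sobolevNorm M G
  have hS : 0 ≤ S := sobolevNorm_nonneg M G
  have hI₀ : ∫ z, ‖amp G V μ c 0 z‖ ≤ C₀ * S := by
    have := H₀ G hG μ c
    simp only [iteratedDeriv_zero, pow_zero, mul_one] at this
    exact this.trans (mul_le_mul_of_nonneg_left (sobolevNorm_mono (Nat.zero_le M) G) h₀)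
  have hI₁ := H₁ G hG μ c
  refine (norm_tsum_periodic_le (bump_amp hG hV μ c 0) hq hper hKl hX hM).trans ?_
  calc _ ≤ (q * (4 * q) * Z) * (X / q * (C₀ * S)) +
        q * (4 * q) * (poissonConst * ((q / X) ^ M * (X / q) * (C₁ * (1 + |μ|) ^ M * S))) := by
        gcongr
    _ = 4 * C₀ * S * (q * X) * Z +
        4 * (poissonConst * C₁) * S * (q * X) * (q / X * (1 + |μ|)) ^ M := by
        rw [mul_pow]
        field_simp
    _ ≤ _ := by
        -- The two cross terms of the product (C₀ + `poissonConst` * C₁)(Y + Z) are nonnegative and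
        -- may be added.
        have hY : 0 ≤ (q / X * (1 + |μ|)) ^ M := by positivity
        have a1 : 0 ≤ 4 * C₀ * S * (q * X) * (q / X * (1 + |μ|)) ^ M := by positivity
        have a2 : 0 ≤ 4 * (poissonConst * C₁) * S * (q * X) * Z := by positivity
        nlinarith

/-- With y = Xz the phase becomes a multiple of √z and log t is shifted by -½ log z, so for fixed θ
all dependence on n sits in one amplitude evaluated at n/X. -/
theorem amp_div_eq (G V : ℝ → ℂ) (l f : ℕ) (hl : 1 ≤ l) (hf : 1 ≤ f) (ξ : ℤ) {X y : ℝ} (hX : 0 < X)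
    (hy : 0 < y) (θ : ℝ) :
    amp G V (-(π * (ξ * sqrt X / (l * f ^ 2)) * cos θ))
        (log (l * f ^ 2 / sqrt (4 * X)) - log (sin θ)) 0 (y / X) =
      G (y / X) * osc (ξ * sqrt y / (2 * (l * f ^ 2))) θ *
        V (log (l * f ^ 2 / sqrt (4 * y)) - log (sin θ)) := by
  have hl0 : (0 : ℝ) < l := by exact_mod_cast hl
  have hf0 : (0 : ℝ) < f := by exact_mod_cast hf
  have hq : (0 : ℝ) < l * f ^ 2 := by positivity
  have hsX : 0 < sqrt X := sqrt_pos.2 hX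
  have h1 : sqrt y = sqrt X * sqrt (y / X) := by
    rw [← sqrt_mul hX.le, mul_div_cancel₀ _ hX.ne']
  have h2 : log (l * f ^ 2 / sqrt (4 * y)) =
      log (l * f ^ 2 / sqrt (4 * X)) - 1 / 2 * log (y / X) := by
    rw [log_div hq.ne' (by positivity), log_div hq.ne' (by positivity), log_sqrt (by positivity),
      log_sqrt (by positivity), log_mul (by norm_num) hy.ne', log_mul (by norm_num) hX.ne',
      log_div hy.ne' hX.ne']
    ring
  rw [amp, osc, h2, h1, neg_zero, rpow_zero]
  have e1 : -(π * (ξ * sqrt X / (l * f ^ 2)) * cos θ) * sqrt (y / X) =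
      -(2 * π * (ξ * (sqrt X * sqrt (y / X)) / (2 * (l * f ^ 2))) * cos θ) := by
    field_simp
  rw [e1, sub_right_comm]
  simp

/-- The finite sum over n is moved inside the integral over θ. Poisson summation is applied for each
fixed θ, with bounds uniform in θ, and the integral then costs only the length π. -/
theorem exists_term_le (k : ℕ) {M : ℕ} (hM : 2 ≤ M) :
    ∃ C, 0 ≤ C ∧ ∀ G, Bump G → ∀ l f : ℕ, 1 ≤ l → 1 ≤ f → ∀ ξ : ℤ, ξ ≠ 0 → ∀ X : ℝ, 0 < X →
      ‖∑' n : ℤ, G (n / X) * (sqrt n : ℂ) * Kl l f ξ n * I k l f ξ n‖ ≤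
        C * sobolevNorm M G * X * ((l * f ^ 2 : ℕ) ^ 2 / |(ξ : ℝ)|) *
          (((l * f ^ 2 : ℕ) / X + |(ξ : ℝ)| / sqrt X) ^ M + meanIndicator l f ξ) := by
  obtain ⟨C₁, h₁, H₁⟩ := exists_sum_amp_le smoothBounded_weight hM
  obtain ⟨C₂, h₂, H₂⟩ := exists_sum_amp_le smoothBounded_weight.deriv hM
  obtain ⟨CW, hCW, hCW'⟩ := exists_weight_le
  refine ⟨1 / π * ((k - 1 : ℕ) * (C₁ + C₂)) * π ^ M, by positivity,
    fun G hG l f hl hf ξ hξ X hX => ?_⟩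
  specialize H₁ G hG l f hl hf ξ hξ X hX
  specialize H₂ G hG l f hl hf ξ hξ X hX
  have hZ := meanIndicator_nonneg l f ξ
  set Z := meanIndicator l f ξ
  set S := sobolevNorm M G
  have hS : 0 ≤ S := sobolevNorm_nonneg M G
  have hl0 : (0 : ℝ) < l := by exact_mod_cast hl
  have hf0 : (0 : ℝ) < f := by exact_mod_cast hf
  have hξ0 : (ξ : ℝ) ≠ 0 := by exact_mod_cast hξ
  have hξa : 0 < |(ξ : ℝ)| := abs_pos.2 hξ0
  have hsX : 0 < sqrt X := sqrt_pos.2 hX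
  have hcast : ((l * f ^ 2 : ℕ) : ℝ) = l * f ^ 2 := by push_cast; ring
  rw [hcast] at H₁ H₂ ⊢
  set q : ℝ := l * f ^ 2 with hqdef
  have hq0 : 0 < q := by positivity
  set N := (hG.finite_support_int hX).toFinset with hN
  have hmem : ∀ n ∈ N, (0 : ℝ) < n := by
    intro n hn
    rw [hN, Set.Finite.mem_toFinset] at hn
    by_contra h
    refine hn (hG.eq_zero fun h' => ?_)
    have : (n : ℝ) / X ≤ 0 := div_nonpos_of_nonpos_of_nonneg (not_lt.1 h) hX.le
    linarith [h'.1]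
  have hnot : ∀ n ∉ N, G ((n : ℝ) / X) = 0 := by
    intro n hn
    simpa [hN] using hn
  -- The factor √n of the sum cancels the √n in the gain 1/μ from integration by parts, so this
  -- constant is independent of n.
  set κ₀ : ℂ := q / (π ^ 2 * ξ * Complex.I) with hκ₀
  set E : ℤ → ℝ → ℂ := fun n θ => osc (ξ * sqrt n / (2 * q)) θ *
        (coeffA (k - 1) θ * weight (log (q / sqrt (4 * n)) - log (sin θ)) +
          coeffB (k - 1) θ * deriv weight (log (q / sqrt (4 * n)) - log (sin θ))) with hE
  have hterm : ∀ n ∈ N, G (n / X) * (sqrt n : ℂ) * Kl l f ξ n * I k l f ξ n =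
      κ₀ * ∫ θ in Ioo 0 π, Kl l f ξ n * G (n / X) * E n θ := by
    intro n hn
    have hs : (sqrt (n : ℝ) : ℂ) ≠ 0 := by exact_mod_cast (sqrt_pos.2 (hmem n hn)).ne'
    have hq' : (q : ℂ) ≠ 0 := by exact_mod_cast hq0.ne'
    have hξ' : (ξ : ℂ) ≠ 0 := by exact_mod_cast hξ
    have hπ : (π : ℂ) ≠ 0 := by exact_mod_cast pi_ne_zero
    have hI : I k l f ξ n = 1 / (2 * π ^ 2 * (ξ * sqrt n / (2 * q) : ℝ) * Complex.I) *
        ∫ θ in Ioo 0 π, E n θ := I_eq k hl hf hξ (hmem n hn)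
    rw [hI, integral_const_mul, hκ₀]
    push_cast
    field_simp
  have hint : ∀ n ∈ N, IntegrableOn (fun θ => Kl l f ξ n * G (n / X) * E n θ) (Ioo 0 π) := by
    intro n _
    refine Integrable.const_mul ?_ _
    exact Integrable.of_bound ((continuousOn_byParts contDiff_weight.continuous
      continuous_deriv_weight (k - 1) _ _).aestronglyMeasurable measurableSet_Ioo) _
      (.of_forall fun θ => norm_byParts_le hCW hCW' (k - 1) _ _ θ)
  rw [tsum_eq_sum (s := N) (fun n hn => by simp [hnot n hn]), Finset.sum_congr rfl hterm,
    ← Finset.mul_sum, ← integral_finsetSum _ hint]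
  set Y := (q / X + |(ξ : ℝ)| / sqrt X) ^ M with hY
  have hpt : ∀ θ ∈ Ioo 0 π, ‖∑ n ∈ N, Kl l f ξ n * G (n / X) * E n θ‖ ≤
      (k - 1 : ℕ) * (C₁ + C₂) * S * (q * X) * (π ^ M * (Y + Z)) := by
    intro θ _
    set μ : ℝ := -(π * (ξ * sqrt X / q) * cos θ) with hμ
    set c : ℝ := log (q / sqrt (4 * X)) - log (sin θ) with hc
    have hsum : ∑ n ∈ N, Kl l f ξ n * G (n / X) * E n θ =
        coeffA (k - 1) θ * ∑' n : ℤ, Kl l f ξ n * amp G weight μ c 0 (n / X) +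
        coeffB (k - 1) θ * ∑' n : ℤ, Kl l f ξ n * amp G (deriv weight) μ c 0 (n / X) := by
      rw [tsum_eq_sum (s := N) (fun n hn => by simp [amp, hnot n hn]),
        tsum_eq_sum (s := N) (fun n hn => by simp [amp, hnot n hn]), Finset.mul_sum,
        Finset.mul_sum, ← Finset.sum_add_distrib]
      refine Finset.sum_congr rfl fun n hn => ?_
      rw [hμ, hc, hqdef, amp_div_eq G _ l f hl hf ξ hX (hmem n hn) θ,
        amp_div_eq G _ l f hl hf ξ hX (hmem n hn) θ, hE]
      ring
    have hμle : |μ| ≤ π * (|(ξ : ℝ)| * sqrt X / q) := by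
      rw [hμ, abs_neg, abs_mul, abs_mul, abs_of_pos pi_pos, abs_div, abs_mul, abs_of_pos hsX,
        abs_of_pos hq0]
      exact mul_le_of_le_one_right (by positivity) (abs_cos_le_one θ)
    have hfac : q / X * (1 + |μ|) ≤ π * (q / X + |(ξ : ℝ)| / sqrt X) := by
      have e1 : q / X * (π * (|(ξ : ℝ)| * sqrt X / q)) = π * (|(ξ : ℝ)| / sqrt X) := by
        have : q / X * (π * (|(ξ : ℝ)| * sqrt X / q)) = π * |(ξ : ℝ)| * (sqrt X / X) := by
          field_simp
        rw [this, sqrt_div_self']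
        ring
      have e2 : q / X ≤ π * (q / X) :=
        le_mul_of_one_le_left (by positivity) (by linarith [pi_gt_three])
      calc q / X * (1 + |μ|) ≤ q / X * (1 + π * (|(ξ : ℝ)| * sqrt X / q)) := by gcongr
        _ = q / X + π * (|(ξ : ℝ)| / sqrt X) := by rw [mul_add, e1, mul_one]
        _ ≤ _ := by rw [mul_add]; gcongr
    have hYZ : (q / X * (1 + |μ|)) ^ M + Z ≤ π ^ M * (Y + Z) := by
      rw [mul_add (π ^ M), hY, ← mul_pow]
      refine add_le_add (by gcongr) (le_mul_of_one_le_left hZ (one_le_pow₀ ?_))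
      linarith [pi_gt_three]
    rw [hsum]
    refine (norm_add_le _ _).trans ?_
    rw [norm_mul, norm_mul, Complex.norm_real, Complex.norm_real, Real.norm_eq_abs,
      Real.norm_eq_abs]
    calc _ ≤ (k - 1 : ℕ) * (C₁ * S * (q * X) * (π ^ M * (Y + Z))) +
          (k - 1 : ℕ) * (C₂ * S * (q * X) * (π ^ M * (Y + Z))) := by
          gcongr
          · exact abs_coeffA_le _ θ
          · exact (H₁ μ c).trans (by gcongr)
          · exact abs_coeffB_le _ θ
          · exact (H₂ μ c).trans (by gcongr)
      _ = _ := by ring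
  have hbd := norm_setIntegral_le_of_norm_le_const (μ := volume) (s := Ioo 0 π) (by simp) hpt
  have hvol : volume.real (Ioo 0 π) = π := by simp [Measure.real, pi_pos.le]
  rw [hvol] at hbd
  rw [norm_mul]
  have hκn : ‖κ₀‖ = q / (π ^ 2 * |(ξ : ℝ)|) := by
    rw [hκ₀, norm_div, norm_mul, norm_mul, norm_pow, Complex.norm_I, Complex.norm_real,
      Complex.norm_real, Real.norm_of_nonneg hq0.le, Real.norm_of_nonneg pi_pos.le,
      Complex.norm_intCast, mul_one]
  rw [hκn]
  calc _ ≤ q / (π ^ 2 * |(ξ : ℝ)|) *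
        ((k - 1 : ℕ) * (C₁ + C₂) * S * (q * X) * (π ^ M * (Y + Z)) * π) := by gcongr
    _ = _ := by
      field_simp

/-! ### Summation over the critical range -/

/-- For fixed f and ξ ≠ 0 there are at most Z/(f²|ξ|) values of l, contributing at most Z/f in
total. The sum over f is harmonic and there are at most 2B + 1 values of ξ. -/
theorem sum_range_triples_le {T : Finset (ℕ × ℕ × ℤ)} {Z A B : ℝ} (hB : 0 ≤ B) (hZ : 0 ≤ Z)
    (hT : ∀ p ∈ T, 1 ≤ p.1 ∧ 1 ≤ p.2.1 ∧ p.2.2 ≠ 0 ∧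
      (p.1 : ℝ) * (p.2.1 : ℝ) ^ 2 * |(p.2.2 : ℝ)| ≤ Z ∧ (p.2.1 : ℝ) ≤ A ∧ |(p.2.2 : ℝ)| ≤ B) :
    ∑ p ∈ T, (p.2.1 : ℝ) * |(p.2.2 : ℝ)| ≤ Z * (2 * B + 1) * (1 + log (⌊A⌋₊ : ℝ)) := by
  set U := Finset.Icc 1 ⌊A⌋₊ ×ˢ Finset.Icc (-⌊B⌋) ⌊B⌋ with hU
  have hmaps : ∀ p ∈ T, p.2 ∈ U := by
    intro p hp
    obtain ⟨-, hf, -, -, hA, hB⟩ := hT p hp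
    rw [hU, Finset.mem_product, Finset.mem_Icc, Finset.mem_Icc]
    exact ⟨⟨hf, Nat.le_floor hA⟩, abs_le.1 (Int.le_floor.2 (by exact_mod_cast hB))⟩
  rw [← Finset.sum_fiberwise_of_maps_to hmaps]
  have hfib : ∀ u ∈ U, ∑ p ∈ T with p.2 = u, (p.2.1 : ℝ) * |(p.2.2 : ℝ)| ≤ Z * (1 / (u.1 : ℝ)) := by
    rintro ⟨f, ξ⟩ hu
    have hf : 1 ≤ f := (Finset.mem_Icc.1 (Finset.mem_product.1 hu).1).1
    have hf0 : (0 : ℝ) < f := by exact_mod_cast hf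
    have hc : ∑ p ∈ T with p.2 = (f, ξ), (p.2.1 : ℝ) * |(p.2.2 : ℝ)| =
        (T.filter fun p => p.2 = (f, ξ)).card * ((f : ℝ) * |(ξ : ℝ)|) := by
      rw [← nsmul_eq_mul]
      refine Finset.sum_eq_card_nsmul fun p hp => ?_
      rw [(Finset.mem_filter.1 hp).2]
    rw [hc]
    rcases eq_or_ne ξ 0 with rfl | hξ
    · simp only [Int.cast_zero, abs_zero, mul_zero]
      positivity
    have hξ0 : 0 < |(ξ : ℝ)| := abs_pos.2 (by exact_mod_cast hξ)
    have hcard : (T.filter fun p => p.2 = (f, ξ)).card ≤ ⌊Z / (f ^ 2 * |(ξ : ℝ)|)⌋₊ := by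
      rw [← Nat.add_sub_cancel (n := ⌊Z / (f ^ 2 * |(ξ : ℝ)|)⌋₊) (m := 1), ← Nat.card_Icc]
      refine Finset.card_le_card_of_injOn (fun p => p.1) (fun p hp => ?_) fun p hp r hr h => ?_
      · obtain ⟨hp, hp2⟩ := Finset.mem_filter.1 hp
        obtain ⟨hl, -, -, hz, -, -⟩ := hT p hp
        rw [hp2] at hz
        simp only [Finset.coe_Icc, Set.mem_Icc]
        refine ⟨hl, Nat.le_floor ?_⟩
        rw [le_div_iff₀ (by positivity)]
        linarith
      · exact Prod.ext h ((Finset.mem_filter.1 hp).2.trans (Finset.mem_filter.1 hr).2.symm)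
    calc ((T.filter fun p => p.2 = (f, ξ)).card : ℝ) * ((f : ℝ) * |(ξ : ℝ)|) ≤
        (Z / (f ^ 2 * |(ξ : ℝ)|)) * (f * |(ξ : ℝ)|) := by
          gcongr
          exact (Nat.cast_le.2 hcard).trans (Nat.floor_le (by positivity))
      _ = Z * (1 / f) := by field_simp
  refine (Finset.sum_le_sum hfib).trans ?_
  rw [hU, Finset.sum_product_right]
  simp only [Finset.sum_const, ← Finset.mul_sum]
  have hh : ∑ i ∈ Finset.Icc 1 ⌊A⌋₊, 1 / (i : ℝ) ≤ 1 + log (⌊A⌋₊ : ℝ) := by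
    have := harmonic_le_one_add_log ⌊A⌋₊
    rw [harmonic_eq_sum_Icc] at this
    push_cast at this
    simpa only [one_div] using this
  have hcardB : ((Finset.Icc (-⌊B⌋) ⌊B⌋).card : ℝ) ≤ 2 * B + 1 := by
    have h0 : 0 ≤ ⌊B⌋ := Int.floor_nonneg.2 hB
    have h1 : (((Finset.Icc (-⌊B⌋) ⌊B⌋).card : ℤ) : ℝ) = 2 * ⌊B⌋ + 1 := by
      rw [Int.card_Icc, Int.toNat_of_nonneg (by omega)]
      push_cast
      ring
    have h2 := Int.floor_le B
    rw [Int.cast_natCast] at h1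
    rw [h1]
    linarith
  have hpos : 0 ≤ ∑ i ∈ Finset.Icc 1 ⌊A⌋₊, 1 / (i : ℝ) :=
    Finset.sum_nonneg fun i _ => by positivity
  rw [nsmul_eq_mul]
  calc _ ≤ (2 * B + 1) * (Z * (1 + log (⌊A⌋₊ : ℝ))) := by gcongr
    _ = _ := by ring

theorem exists_log_floor_le {c : ℝ} (hc : 0 < c) {s : ℝ} (hs : 0 ≤ s) :
    ∃ C, 0 ≤ C ∧ ∀ X : ℝ, 2 ≤ X → 1 + log (⌊c * X ^ s⌋₊ : ℝ) ≤ C * log X := by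
  have hl2 : 0 < log 2 := log_pos one_lt_two
  have hm : 0 ≤ log (max c 1) := log_nonneg (le_max_right _ _)
  -- Since X ≥ 2, each constant is at most itself times log X / log 2. The maximum with 1 keeps the
  -- logarithm nonnegative, which also covers the floor being 0, where log 0 = 0.
  refine ⟨1 / log 2 + log (max c 1) / log 2 + s, by positivity, fun X hX => ?_⟩
  have hX0 : 0 < X := by linarith
  have hlX : log 2 ≤ log X := log_le_log (by norm_num) hX
  have hlX0 : 0 ≤ log X := hl2.le.trans hlX
  have h1 : 1 ≤ 1 / log 2 * log X := by
    rw [one_div, inv_mul_eq_div, one_le_div hl2]; exact hlX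
  have h2 : log (max c 1) ≤ log (max c 1) / log 2 * log X := by
    rw [div_mul_eq_mul_div, le_div_iff₀ hl2]
    exact mul_le_mul_of_nonneg_left hlX hm
  have h3 : log (⌊c * X ^ s⌋₊ : ℝ) ≤ log (max c 1) + s * log X := by
    rcases Nat.eq_zero_or_pos ⌊c * X ^ s⌋₊ with h | h
    · rw [h, Nat.cast_zero, log_zero]
      positivity
    · have hpos : 0 < max c 1 := lt_max_of_lt_left hc
      rw [← log_rpow hX0, ← log_mul hpos.ne' (by positivity)]
      refine log_le_log (by exact_mod_cast h) ((Nat.floor_le (by positivity)).trans ?_)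
      gcongr
      exact le_max_left _ _
  linarith

/-- A nonzero indicator forces 2c₁X^(1/4-κ) ≤ c₄X^(1/6+κ+α), that is X^δ ≤ c₄/(2c₁) with δ > 0, so X
≤ X₀. As |ξ| ≥ 1, the factor √X₀ |ξ|/√X is then at least 1. The bound is put in this form so that it
merges with the Poisson error term. -/
theorem exists_meanIndicator_le {c₁ c₂ c₃ c₄ κ α : ℝ} (hc₁ : 0 < c₁) (hc₄ : 0 < c₄)
    (hκα : 2 * κ + α < 1 / 12) (M : ℕ) :
    ∃ C, 0 ≤ C ∧ ∀ X : ℝ, 2 ≤ X → ∀ p ∈ criticalRange c₁ c₂ c₃ c₄ κ α X,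
      meanIndicator p.1 p.2.1 p.2.2 ≤ C * (|(p.2.2 : ℝ)| / sqrt X) ^ M := by
  set δ := 1 / 12 - 2 * κ - α with hδ
  have hδ0 : 0 < δ := by linarith
  set X₀ := (c₄ / (2 * c₁)) ^ (1 / δ) with hX₀
  have hX₀0 : 0 < X₀ := by positivity
  refine ⟨sqrt X₀ ^ M, by positivity, ?_⟩
  rintro X hX ⟨l, f, ξ⟩ ⟨hl, hf, hξ, hlow, -, -, hup⟩
  simp only at hl hf hξ hlow hup ⊢
  have hX0 : 0 < X := by linarith
  have hsX : 0 < sqrt X := sqrt_pos.2 hX0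
  unfold meanIndicator
  split_ifs with h
  · positivity
  have h1 : 2 * ((l : ℝ) * (f : ℝ) ^ 2) ≤ |(ξ : ℝ)| := by exact_mod_cast not_lt.1 h
  have h2 : X ^ δ ≤ c₄ / (2 * c₁) := by
    rw [le_div_iff₀ (by positivity)]
    have e1 : X ^ (1 / 6 + κ + α) * X ^ δ = X ^ (1 / 4 - κ) := by
      rw [← rpow_add hX0, hδ]
      ring_nf
    have hp : 0 < X ^ (1 / 6 + κ + α) := by positivity
    refine le_of_mul_le_mul_left ?_ hp
    calc X ^ (1 / 6 + κ + α) * (X ^ δ * (2 * c₁)) = 2 * (c₁ * X ^ (1 / 4 - κ)) := by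
          rw [← e1]; ring
      _ ≤ c₄ * X ^ (1 / 6 + κ + α) := by linarith
      _ = _ := by ring
  have h3 : X ≤ X₀ := by
    have := rpow_le_rpow (by positivity) h2 (show 0 ≤ 1 / δ by positivity)
    rwa [← rpow_mul hX0.le, mul_one_div_cancel hδ0.ne', rpow_one] at this
  have hξ1 : 1 ≤ |(ξ : ℝ)| := by exact_mod_cast Int.one_le_abs hξ
  rw [← mul_pow]
  refine one_le_pow₀ ?_
  rw [← mul_div_assoc, one_le_div hsX]
  calc sqrt X ≤ sqrt X₀ := sqrt_le_sqrt h3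
    _ ≤ sqrt X₀ * |(ξ : ℝ)| := le_mul_of_one_le_right (sqrt_nonneg _) hξ1

theorem SG_eq (k : ℕ) (c₁ c₂ c₃ c₄ κ α : ℝ) {G : ℝ → ℂ} (hG : Bump G) {X : ℝ} (hX : 0 < X) :
    SG k c₁ c₂ c₃ c₄ κ α G X =
      ∑ p ∈ (criticalRange_finite c₁ c₂ c₃ c₄ κ α X).toFinset,
        1 / ((p.1 : ℂ) ^ 2 * (p.2.1 : ℂ) ^ 3) *
          ∑' n : ℤ, G (n / X) * (sqrt n : ℂ) * Kl p.1 p.2.1 p.2.2 n * I k p.1 p.2.1 p.2.2 n := by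
  have hs : ∀ p : ℕ × ℕ × ℤ, Summable fun n : ℤ => 1 / ((p.1 : ℂ) ^ 2 * (p.2.1 : ℂ) ^ 3) *
      (G (n / X) * (sqrt n : ℂ) * Kl p.1 p.2.1 p.2.2 n * I k p.1 p.2.1 p.2.2 n) := fun p => by
    refine summable_of_hasFiniteSupport ((hG.finite_support_int hX).subset fun n hn => ?_)
    simp only [Function.mem_support] at hn ⊢
    exact fun h => hn (by simp [h])
  simp only [← tsum_mul_left]
  rw [← Summable.tsum_finsetSum fun p _ => hs p, SG]
  refine tsum_congr fun n => ?_
  rw [Finset.mul_sum]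
  exact Finset.sum_congr rfl fun p _ => by ring

/-- The saving of `M` integrations by parts on the critical range. -/
theorem saving_le {c₁ c₂ c₃ c₄ κ α X : ℝ} (hc₂ : 0 < c₂) (hc₄ : 0 < c₄) (hκ : 0 < κ) (hα : 0 < α)
    (hX : 2 ≤ X) {p : ℕ × ℕ × ℤ} (hp : p ∈ criticalRange c₁ c₂ c₃ c₄ κ α X) {M : ℕ} (hM : 2 ≤ M) :
    ((p.1 * p.2.1 ^ 2 : ℕ) / X + |(p.2.2 : ℝ)| / sqrt X) ^ M ≤
      (c₂ + c₄) ^ (M - 2) * (c₂ + 1) ^ 2 * |(p.2.2 : ℝ)| ^ 2 *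
        X ^ (-1 + 2 * κ + ((M : ℝ) - 2) * (-1 / 3 + κ + α)) := by
  obtain ⟨l, f, ξ⟩ := p
  obtain ⟨hl, hf, hξ, -, hq, -, hup⟩ := hp
  simp only at hl hf hξ hq hup ⊢
  have hX0 : 0 < X := by linarith
  have hX1 : 1 ≤ X := by linarith
  have hξ1 : 1 ≤ |(ξ : ℝ)| := by exact_mod_cast Int.one_le_abs hξ
  have hs : sqrt X = X ^ (1 / 2 : ℝ) := sqrt_eq_rpow X
  have hqX : ((l * f ^ 2 : ℕ) : ℝ) / X ≤ c₂ * X ^ (-1 / 2 + κ) := by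
    rw [div_le_iff₀ hX0, mul_assoc, ← rpow_add_one hX0.ne']
    push_cast
    convert! hq using 3
    ring
  set a := ((l * f ^ 2 : ℕ) : ℝ) / X + |(ξ : ℝ)| / sqrt X with ha
  have ha0 : 0 ≤ a := by positivity
  -- This bound is used for M - 2 of the factors and is governed by the upper bound on |ξ|.
  have h1 : a ≤ (c₂ + c₄) * X ^ (-1 / 3 + κ + α) := by
    rw [ha, add_mul]
    refine add_le_add (hqX.trans ?_) ?_
    · gcongr ?_ * ?_
      exact rpow_le_rpow_of_exponent_le hX1 (by linarith)
    · rw [div_le_iff₀ (sqrt_pos.2 hX0), hs, mul_assoc, ← rpow_add hX0]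
      convert! hup using 3
      ring
  -- This bound is used for two factors. It keeps |ξ| explicit, so that |ξ|²/|ξ| = |ξ| can later be
  -- summed using the constraint on lf²|ξ|; |ξ| ≥ 1 is what absorbs q/X.
  have h2 : a ≤ (c₂ + 1) * |(ξ : ℝ)| * X ^ (-1 / 2 + κ) := by
    have hp0 : 0 < X ^ (-1 / 2 + κ) := by positivity
    have h3 : |(ξ : ℝ)| / sqrt X ≤ |(ξ : ℝ)| * X ^ (-1 / 2 + κ) := by
      rw [div_eq_mul_inv, hs, ← rpow_neg hX0.le]
      gcongr
      linarith
    have h4 : c₂ * X ^ (-1 / 2 + κ) ≤ c₂ * |(ξ : ℝ)| * X ^ (-1 / 2 + κ) := by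
      gcongr
      exact le_mul_of_one_le_right hc₂.le hξ1
    rw [ha]
    linarith
  have hexp : X ^ (-1 + 2 * κ + ((M : ℝ) - 2) * (-1 / 3 + κ + α)) =
      (X ^ (-1 / 3 + κ + α)) ^ (M - 2) * (X ^ (-1 / 2 + κ)) ^ 2 := by
    rw [← rpow_natCast, ← rpow_natCast, ← rpow_mul hX0.le, ← rpow_mul hX0.le, ← rpow_add hX0]
    congr 1
    rw [Nat.cast_sub hM]
    push_cast
    ring
  calc a ^ M = a ^ (M - 2) * a ^ 2 := by rw [← pow_add]; congr 1; omega
    _ ≤ ((c₂ + c₄) * X ^ (-1 / 3 + κ + α)) ^ (M - 2) *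
        ((c₂ + 1) * |(ξ : ℝ)| * X ^ (-1 / 2 + κ)) ^ 2 := by gcongr
    _ = _ := by rw [hexp, mul_pow (c₂ + c₄)]; ring

theorem SG_bound (k : ℕ) {M : ℕ} (hM : 2 ≤ M) {κ α : ℝ} (hκ : 0 < κ) (hα : 0 < α)
    (hκα : 2 * κ + α < 1 / 12) {c₁ c₂ c₃ c₄ : ℝ} (hc₁ : 0 < c₁) (hc₂ : 0 < c₂) (hc₃ : 0 < c₃)
    (hc₄ : 0 < c₄) :
    ∃ C : ℝ, ∀ G : ℝ → ℂ, Bump G → ∀ X : ℝ, 2 ≤ X →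
      ‖SG k c₁ c₂ c₃ c₄ κ α G X‖ ≤ C * sobolevNorm M G *
        X ^ (17 / 12 + 2 * κ + α - (M : ℝ) * (1 / 3 - κ - α)) * log X := by
  obtain ⟨C₁, h₁, H₁⟩ := exists_term_le k hM
  obtain ⟨C₂, h₂, H₂⟩ := exists_meanIndicator_le (c₂ := c₂) (c₃ := c₃) hc₁ hc₄ hκα M
  obtain ⟨C₃, h₃, H₃⟩ := exists_log_floor_le hc₂ (s := 1 / 2 + κ) (by linarith)
  refine ⟨C₁ * (1 + C₂) * ((c₂ + c₄) ^ (M - 2) * (c₂ + 1) ^ 2) * c₃ * (2 * c₄ + 1) * C₃,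
    fun G hG X hX => ?_⟩
  have hX0 : 0 < X := by linarith
  have hX1 : 1 ≤ X := by linarith
  rw [SG_eq k c₁ c₂ c₃ c₄ κ α hG hX0]
  set T := (criticalRange_finite c₁ c₂ c₃ c₄ κ α X).toFinset with hT
  have hmem : ∀ p ∈ T, p ∈ criticalRange c₁ c₂ c₃ c₄ κ α X := fun p hp => by
    simpa [hT] using hp
  set S := sobolevNorm M G
  have hS : 0 ≤ S := sobolevNorm_nonneg M G
  set D := (c₂ + c₄) ^ (M - 2) * (c₂ + 1) ^ 2 with hD
  have hD0 : 0 ≤ D := by positivity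
  set s := -1 + 2 * κ + ((M : ℝ) - 2) * (-1 / 3 + κ + α) with hs
  have hterm : ∀ p ∈ T, ‖1 / ((p.1 : ℂ) ^ 2 * (p.2.1 : ℂ) ^ 3) *
      ∑' n : ℤ, G (n / X) * (sqrt n : ℂ) * Kl p.1 p.2.1 p.2.2 n * I k p.1 p.2.1 p.2.2 n‖ ≤
      C₁ * (1 + C₂) * D * S * X * X ^ s * ((p.2.1 : ℝ) * |(p.2.2 : ℝ)|) := by
    intro p hp
    have hp' := hmem p hp
    have hsav := saving_le hc₂ hc₄ hκ hα hX hp' hM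
    have hind := H₂ X hX p hp'
    obtain ⟨hl, hf, hξ, -⟩ := hp'
    have ht := H₁ G hG p.1 p.2.1 hl hf p.2.2 hξ X hX0
    rw [← hD, ← hs] at hsav
    have hl0 : (0 : ℝ) < p.1 := by exact_mod_cast hl
    have hf0 : (0 : ℝ) < p.2.1 := by exact_mod_cast hf
    have hξ0 : 0 < |(p.2.2 : ℝ)| := abs_pos.2 (by exact_mod_cast hξ)
    have hsX : 0 < sqrt X := sqrt_pos.2 hX0
    set q : ℝ := ((p.1 * p.2.1 ^ 2 : ℕ) : ℝ) with hq
    have hq' : q = p.1 * (p.2.1 : ℝ) ^ 2 := by rw [hq]; push_cast; ring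
    have hq0 : 0 < q := by rw [hq']; positivity
    set a := q / X + |(p.2.2 : ℝ)| / sqrt X with ha
    have hind' : meanIndicator p.1 p.2.1 p.2.2 ≤ C₂ * a ^ M := by
      refine hind.trans ?_
      gcongr
      rw [ha]
      exact le_add_of_nonneg_left (by positivity)
    rw [norm_mul, norm_div, norm_one, norm_mul, norm_pow, norm_pow, Complex.norm_natCast,
      Complex.norm_natCast]
    calc _ ≤ 1 / ((p.1 : ℝ) ^ 2 * (p.2.1 : ℝ) ^ 3) *
          (C₁ * S * X * (q ^ 2 / |(p.2.2 : ℝ)|) * (a ^ M + C₂ * a ^ M)) := by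
          gcongr
          exact ht.trans (by gcongr)
      _ = C₁ * (1 + C₂) * S * X * (p.2.1 / |(p.2.2 : ℝ)|) * a ^ M := by
          rw [hq']
          field_simp
      _ ≤ C₁ * (1 + C₂) * S * X * (p.2.1 / |(p.2.2 : ℝ)|) * (D * |(p.2.2 : ℝ)| ^ 2 * X ^ s) := by
          gcongr
      _ = _ := by
          field_simp
  have hsum := sum_range_triples_le (T := T) (Z := c₃ * X ^ (1 / 2 + κ))
    (A := c₂ * X ^ (1 / 2 + κ)) (B := c₄ * X ^ (1 / 6 + κ + α)) (by positivity) (by positivity)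
    (fun p hp => by
      obtain ⟨hl, hf, hξ, -, hq, hz, hb⟩ := hmem p hp
      refine ⟨hl, hf, hξ, hz, le_trans ?_ hq, hb⟩
      have hl' : (1 : ℝ) ≤ p.1 := by exact_mod_cast hl
      have hf' : (1 : ℝ) ≤ p.2.1 := by exact_mod_cast hf
      calc (p.2.1 : ℝ) ≤ (p.2.1 : ℝ) ^ 2 := le_self_pow₀ hf' two_ne_zero
        _ ≤ _ := le_mul_of_one_le_left (by positivity) hl')
  have hlog := H₃ X hX
  have hlX : 0 ≤ log X := log_nonneg hX1
  have hB : 2 * (c₄ * X ^ (1 / 6 + κ + α)) + 1 ≤ (2 * c₄ + 1) * X ^ (1 / 6 + κ + α) := by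
    have : 1 ≤ X ^ (1 / 6 + κ + α) := one_le_rpow hX1 (by linarith)
    linarith
  -- The exponent on the left equals 4/3 + 2κ - α - M(1/3 - κ - α), which is smaller than the one
  -- required.
  have hexp : X * X ^ s * X ^ (1 / 2 + κ) * X ^ (1 / 6 + κ + α) ≤
      X ^ (17 / 12 + 2 * κ + α - (M : ℝ) * (1 / 3 - κ - α)) := by
    rw [mul_comm X, ← rpow_add_one hX0.ne', ← rpow_add hX0, ← rpow_add hX0]
    refine rpow_le_rpow_of_exponent_le hX1 ?_
    rw [hs]
    linarith
  calc _ ≤ ∑ p ∈ T, C₁ * (1 + C₂) * D * S * X * X ^ s * ((p.2.1 : ℝ) * |(p.2.2 : ℝ)|) :=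
        norm_sum_le_of_le _ hterm
    _ = C₁ * (1 + C₂) * D * S * X * X ^ s * ∑ p ∈ T, (p.2.1 : ℝ) * |(p.2.2 : ℝ)| := by
        rw [Finset.mul_sum]
    _ ≤ C₁ * (1 + C₂) * D * S * X * X ^ s * (c₃ * X ^ (1 / 2 + κ) *
        ((2 * c₄ + 1) * X ^ (1 / 6 + κ + α)) * (C₃ * log X)) := by
        gcongr
        refine hsum.trans ?_
        gcongr
    _ = C₁ * (1 + C₂) * D * c₃ * (2 * c₄ + 1) * C₃ * S *
        (X * X ^ s * X ^ (1 / 2 + κ) * X ^ (1 / 6 + κ + α)) * log X := by ring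
    _ ≤ _ := by gcongr

end CriticalRange

theorem theorem4p9 (k : ℕ) (hk : 3 ≤ k) (M : ℕ) (hM : 2 ≤ M)
    (κ α : ℝ) (hκ : 0 < κ) (hα : 0 < α) (hκα : 2 * κ + α < 1 / 12)
    (c₁ c₂ c₃ c₄ : ℝ) (hc₁ : 0 < c₁) (hc₂ : 0 < c₂) (hc₃ : 0 < c₃) (hc₄ : 0 < c₄) :
    ∃ C : ℝ, ∀ G : ℝ → ℂ, ContDiff ℝ ∞ G → tsupport G ⊆ Set.Icc (1 / 4) (5 / 4) →
      ∀ X : ℝ, 2 ≤ X →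
        ‖CriticalRange.SG k c₁ c₂ c₃ c₄ κ α G X‖ ≤
          C * CriticalRange.sobolevNorm M G *
            X ^ (17 / 12 + 2 * κ + α - (M : ℝ) * (1 / 3 - κ - α)) * Real.log X := by
  obtain ⟨C, hC⟩ := CriticalRange.SG_bound k hM hκ hα hκα hc₁ hc₂ hc₃ hc₄
  exact ⟨C, fun G hG hs X hX => hC G ⟨hG, hs⟩ X hX⟩
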